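/- **Setting.** Let $\theta^*\in\mathbb R^d$ and $a^i\in\mathbb R^d$, $\alpha^i\in\mathbb R$ for $i\in[1:M]$, $M=K+U$; the constraints $i\le K$ are known, the constraints $i>K$ have unknown $a^i$. Put $\mathcal K=\{x:\langle a^i,x\rangle\le\alpha^i,\ i\le K\}$ and $\mathcal S=\{x\in\mathcal K:\langle a^i,x\rangle\le\alpha^i,\ i>K\}$. Assume: $\mathcal K$ is contained in the closed unit ball (so it is a polytope); $\|\theta^*\|\le1$ and $\|a^i\|\le1$ for all $i$; $\max_{x\in\mathcal S}\langle\theta^*,x\rangle$ is attained at a unique $x^*\in\mathcal S$; at each extreme point of $\mathcal S$ exactly $d$ of the $M$ constraints are tight. In round $t=1,2,\dots$ an action $x_t\in\mathcal K$ is played, and $r_t=\langle\theta^*,x_t\rangle+\gamma^0_t$, $s^i_t=\langle a^i,x_t\rangle+\gamma^i_t$ ($i\le M$) are observed. With $\mathcal F_t=\sigma\big((x_\tau)_{\tau\le t},(r_\tau,s^1_\tau,\dots,s^M_\tau)_{\tau<t}\big)$, the noises satisfy $\mathbb E[\gamma^i_t\mid\mathcal F_t]=0$ and $\mathbb E[e^{\xi\gamma^i_t}\mid\mathcal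 F_t]\le e^{\xi^2/2}$ for all $\xi\in\mathbb R$, $0\le i\le M$. **Algorithm $\mathrm{DOSLB}(\lambda,\delta)$,** $\lambda>0$, $\delta\in(0,1)$. Let $V_{t-1}=\lambda I+\sum_{\tau<t}x_\tau x_\tau^\top$, $\hat\theta_{t-1}=V_{t-1}^{-1}\sum_{\tau<t}r_\tau x_\tau$, $\hat a^i_{t-1}=V_{t-1}^{-1}\sum_{\tau<t}s^i_\tau x_\tau$, $\|z\|_V=\sqrt{\langle z,Vz\rangle}$, and $$\sqrt{\beta_{t-1}}=\sqrt{2\log\Big(\tfrac{(U+1)\det(V_{t-1})^{1/2}\det(\lambda I)^{-1/2}}{\delta}\Big)}+\sqrt\lambda .$$ The confidence sets used in round $t$ are $C^0_t=\{\theta:\|\theta-\hat\theta_{t-1}\|_{V_{t-1}}\le\sqrt{\beta_{t-1}}\}$, $C^i_t=\{a^i\}$ for $i\le K$, and $C^i_t=\{a:\|a-\hat a^i_{t-1}\|_{V_{t-1}}\le\sqrt{\beta_{t-1}}\}$ for $i>K$. With $\widetilde{\mathcal S}_t=\{x\in\mathcal K:\forall i\ \exists \tilde a\in C^i_t,\ \langle\tilde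 a,x\rangle\le\alpha^i\}$, the algorithm takes any $(x_t,\tilde\theta_t)\in\arg\max_{x\in\widetilde{\mathcal S}_t,\ \theta\in C^0_t}\langle\theta,x\rangle$ (and an arbitrary $x_t\in\mathcal K$ if $\widetilde{\mathcal S}_t=\varnothing$). **Basic index sets.** A basic index set (BIS) is an $I\subset[1:M]$ with $|I|=d$. For $x\in\mathcal K$ write $I\sim x$ if $\langle a^i,x\rangle=\alpha^i$ for all $i\in I$, and $I\sim_t x$ if for each $i\in I$ there is $\tilde a\in C^i_t$ with $\langle\tilde a,x\rangle=\alpha^i$. $I$ is optimally associated if $I\sim x^*$, suboptimal otherwise; it is consistent if $I\sim x$ for some $x$. **Gap.** For $L\subset[1:M]$, $J\subset[1:K]\setminus L$ and $v\in\mathbb R^d$ let $\Pi(v;L,J)$ be the program of minimising $\sum_{i\in L,i>K}\pi_i\alpha^i+\sum_{i\in L,i\le K}\rho_i\alpha^i+\sum_{i\in J}\sigma_i\alpha^i$ subject to $\sum_{i\in L,i>K}\pi_ia^i+\sum_{i\in L,i\le K}\rho_ia^i+\sum_{i\in J}\sigma_ia^i=v$, $\sigma\ge0$, and let $\operatorname{spread}(v;L,J)$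 be the infimum of $1+\|\pi\|_1$ over its minimisers $(\pi,\rho,\sigma)$ ($+\infty$ if there are none; a quotient by $+\infty$ is $0$). * For consistent $I$: $\Delta_I=\dfrac{\max(0,\min_{x:I\sim x}\langle\theta^*,x^*-x\rangle)}{\operatorname{spread}(\theta^*;I,[1:K]\setminus I)}$, $\ \Gamma_I=\max_{k\in[1:M]\setminus I}\dfrac{\inf_{x:I\sim x}\langle a^k,x\rangle-\alpha^k}{\operatorname{spread}(-a^k;I,[1:K]\setminus(I\cup\{k\}))}$, $\ \Lambda_I=0$. * For inconsistent $I$: $\Delta_I=\Gamma_I=0$, and with $\mathcal X(\tilde I,\tilde J)=\{x\in\mathbb R^d:\langle a^i,x\rangle=\alpha^i\ (i\in\tilde I),\ \langle a^j,x\rangle\le\alpha^j\ (j\in\tilde J)\}$, $$\Lambda_I=\max\ \max\Big(\tfrac{\max(0,\ \inf_{x\in\mathcal X(\tilde I,\tilde J)}\langle a^k,x\rangle-\alpha^k)}{\operatorname{spread}(-a^k;\tilde I,\tilde J)},\ \tfrac{-\min(0,\ \sup_{x\in\mathcal X(\tilde I,\tilde J)}\langle a^k,x\rangle-\alpha^k)\,\mathbb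 1\{k\in I\}}{\operatorname{spread}(a^k;\tilde I,\tilde J)}\Big),$$ the outer maximum being over $\tilde I\subset I$, $\tilde J\subset[1:K]\setminus I$ with $\mathcal X(\tilde I,\tilde J)\ne\varnothing$ and $k\in[1:M]\setminus(\tilde I\cup\tilde J)$. The gap is $\Xi=\min\{\max(\Delta_I,\Gamma_I,\Lambda_I): I\text{ a suboptimal BIS}\}$. **Theorem.** For every $\lambda>0$ there is a constant $C$, depending only on $\lambda$, such that for every such problem, every $\delta\in(0,1)$ and every run of $\mathrm{DOSLB}(\lambda,\delta)$ the following holds with probability at least $1-\delta$: in every round $t$ with $\langle\tilde\theta_t,x_t\rangle\neq0$ there is a BIS $I_t\sim_t x_t$; and for all $T\ge2$, $$\Xi^2\cdot\#\{t\le T:\ I\sim_t x_t\text{ for some suboptimal BIS } I\}\ \le\ C\Big(1+\log\tfrac{U+1}{\delta}\Big)(d\log T)^2 .$$ In particular, for any choice of $I_t\sim_t x_t$, $\ \sum_{t\le T}(1-\mathbb 1\{I_t\sim x^*\})=O\big((d\log T)^2/\Xi^2\big)$ if $\Xi>0$ (the sum being over the rounds in which some BIS is noisily associated with $x_t$). 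-/

import Mathlib

open MeasureTheory

/-- `ℝ^d` with its Euclidean inner product and norm. -/
abbrev Vec (d : ℕ) : Type := EuclideanSpace ℝ (Fin d)

/-- Indices of the constraints: `Sum.inl i` are the `K` known ones, `Sum.inr j` the `U` unknown
ones. -/
abbrev ConIdx (K U : ℕ) : Type := Fin K ⊕ Fin U

/-- A safe linear bandit problem: objective `θ`, constraints `⟪a i, x⟫ ≤ α i`. -/
structure SafeBandit (d K U : ℕ) where
  θ : Vec d
  a : ConIdx K U → Vec d
  α : ConIdx K U → ℝ

/-- The matrix `V = reg • I + ∑_{τ < t} x_τ x_τᵀ` built from the rounds before round `t`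
(rounds are numbered `0, 1, 2, …`). -/
noncomputable def gramMatrix {d : ℕ} (reg : ℝ) (x : ℕ → Vec d) (t : ℕ) :
    Matrix (Fin d) (Fin d) ℝ :=
  reg • (1 : Matrix (Fin d) (Fin d) ℝ) +
    ∑ τ ∈ Finset.range t, Matrix.vecMulVec (x τ).ofLp (x τ).ofLp

/-- `‖z‖_V = √⟪z, V z⟫`. -/
noncomputable def matNorm {d : ℕ} (V : Matrix (Fin d) (Fin d) ℝ) (z : Vec d) : ℝ :=
  √(z.ofLp ⬝ᵥ V.mulVec z.ofLp)

/-- The regularised least squares estimate from the responses `y_τ` at `x_τ`, `τ < t`. -/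
noncomputable def rlsEstimate {d : ℕ} (reg : ℝ) (x : ℕ → Vec d) (y : ℕ → ℝ) (t : ℕ) : Vec d :=
  WithLp.toLp 2 ((gramMatrix reg x t)⁻¹.mulVec (∑ τ ∈ Finset.range t, y τ • (x τ).ofLp))

/-- The radius of the confidence ellipsoids used in round `t`. -/
noncomputable def confRadius {d : ℕ} (U : ℕ) (reg δ : ℝ) (x : ℕ → Vec d) (t : ℕ) : ℝ :=
  √(2 * Real.log (((U : ℝ) + 1) * √((gramMatrix reg x t).det) *
      (√((reg • (1 : Matrix (Fin d) (Fin d) ℝ)).det))⁻¹ / δ)) + √reg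

/-- The confidence ellipsoid used in round `t`, for the responses `y`. -/
noncomputable def confEllipsoid {d : ℕ} (U : ℕ) (reg δ : ℝ) (x : ℕ → Vec d) (y : ℕ → ℝ)
    (t : ℕ) : Set (Vec d) :=
  {v | matNorm (gramMatrix reg x t) (v - rlsEstimate reg x y t) ≤ confRadius U reg δ x t}

/-- The smallest `σ`-algebra that makes `x_τ` (`τ ≤ t`), and the feedback `r_τ`, `s_τ^i`
(`τ < t`), measurable. -/
@[reducible] def infoSigma {Ω : Type*} {d K U : ℕ} (x : ℕ → Ω → Vec d) (r : ℕ → Ω → ℝ)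
    (s : ℕ → ConIdx K U → Ω → ℝ) (t : ℕ) : MeasurableSpace Ω :=
  (⨆ τ : Fin (t + 1), MeasurableSpace.comap (x τ) inferInstance) ⊔
    (⨆ τ : Fin t, MeasurableSpace.comap (r τ) inferInstance) ⊔
    (⨆ τ : Fin t, ⨆ i : ConIdx K U, MeasurableSpace.comap (s τ i) inferInstance)

/-- Given `ℱ`, the real random variable `η` is conditionally centred and conditionally
`1`-sub-Gaussian. -/
def CondSubGaussian {Ω : Type*} [MeasurableSpace Ω] (μ : Measure Ω) (ℱ : MeasurableSpace Ω)
    (η : Ω → ℝ) : Prop :=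
  Integrable η μ ∧ μ[η | ℱ] =ᵐ[μ] 0 ∧
    ∀ ξ : ℝ, Integrable (fun ω => Real.exp (ξ * η ω)) μ ∧
      μ[fun ω => Real.exp (ξ * η ω) | ℱ] ≤ᵐ[μ] fun _ => Real.exp (ξ ^ 2 / 2)

/-- The indices of the known constraints. -/
def knownIdx (K U : ℕ) : Finset (ConIdx K U) := Finset.univ.filter fun i => i.isLeft = true

/-- The indices of the unknown constraints. -/
def unknownIdx (K U : ℕ) : Finset (ConIdx K U) := Finset.univ.filter fun i => i.isRight = true

namespace SafeBandit

variable {d K U : ℕ}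

/-- The known domain. -/
def knownDomain (B : SafeBandit d K U) : Set (Vec d) :=
  {x | ∀ i : Fin K, inner ℝ (B.a (Sum.inl i)) x ≤ B.α (Sum.inl i)}

/-- The feasible set. -/
def feasible (B : SafeBandit d K U) : Set (Vec d) :=
  {x | x ∈ B.knownDomain ∧ ∀ j : Fin U, inner ℝ (B.a (Sum.inr j)) x ≤ B.α (Sum.inr j)}

/-- `xs` is the unique optimal solution of `max ⟪θ, x⟫` over the feasible set. -/
def IsUniqueOptimum (B : SafeBandit d K U) (xs : Vec d) : Prop :=
  xs ∈ B.feasible ∧ ∀ x ∈ B.feasible, x ≠ xs → inner ℝ B.θ x < inner ℝ B.θ xs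

/-- At every basic feasible solution (extreme point of the feasible set), exactly `d` constraints
hold with equality. -/
def Nondegenerate (B : SafeBandit d K U) : Prop :=
  ∀ x ∈ B.feasible.extremePoints ℝ, {i | inner ℝ (B.a i) x = B.α i}.ncard = d

/-! ### Play -/

/-- The reward `r_t`; the noise index `none` belongs to the reward. -/
noncomputable def reward (B : SafeBandit d K U) {Ω : Type*} (x : ℕ → Ω → Vec d)
    (γ : ℕ → Option (ConIdx K U) → Ω → ℝ) (t : ℕ) (ω : Ω) : ℝ :=
  inner ℝ B.θ (x t ω) + γ t none ω

/-- The safety feedback `s_t^i`. -/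
noncomputable def safety (B : SafeBandit d K U) {Ω : Type*} (x : ℕ → Ω → Vec d)
    (γ : ℕ → Option (ConIdx K U) → Ω → ℝ) (t : ℕ) (i : ConIdx K U) (ω : Ω) : ℝ :=
  inner ℝ (B.a i) (x t ω) + γ t (some i) ω

/-- The confidence set for `a i` used in round `t`: a singleton for known constraints. -/
noncomputable def conf (B : SafeBandit d K U) (reg δ : ℝ) (x : ℕ → Vec d)
    (s : ℕ → ConIdx K U → ℝ) (t : ℕ) : ConIdx K U → Set (Vec d)
  | Sum.inl i => {B.a (Sum.inl i)}
  | Sum.inr j => confEllipsoid U reg δ x (fun τ => s τ (Sum.inr j)) t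

/-- The (optimistic) permissible set of round `t`. -/
def permissible (B : SafeBandit d K U) (reg δ : ℝ) (x : ℕ → Vec d)
    (s : ℕ → ConIdx K U → ℝ) (t : ℕ) : Set (Vec d) :=
  {z | z ∈ B.knownDomain ∧ ∀ i, ∃ v ∈ B.conf reg δ x s t i, inner ℝ v z ≤ B.α i}

/-- In round `t` the pair `(x t, θt t)` is chosen by DOSLB: it maximises `⟪φ, z⟫` over `z` in the
permissible set and `φ` in the confidence set of the objective. If the permissible set is empty
(so that there is no maximiser) the action is an arbitrary point of the known domain. -/
def IsDOSLBRound (B : SafeBandit d K U) (reg δ : ℝ) (x θt : ℕ → Vec d) (r : ℕ → ℝ)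
    (s : ℕ → ConIdx K U → ℝ) (t : ℕ) : Prop :=
  x t ∈ B.knownDomain ∧
    ((B.permissible reg δ x s t).Nonempty →
      x t ∈ B.permissible reg δ x s t ∧ θt t ∈ confEllipsoid U reg δ x r t ∧
      ∀ z ∈ B.permissible reg δ x s t, ∀ φ ∈ confEllipsoid U reg δ x r t,
        inner ℝ φ z ≤ inner ℝ (θt t) (x t))

/-! ### Basic index sets and association -/

/-- `I` is a basic index set: a set of `d` constraints. -/
def IsBIS (_B : SafeBandit d K U) (I : Finset (ConIdx K U)) : Prop := I.card = d

/-- `I ∼ x`. -/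
def Assoc (B : SafeBandit d K U) (I : Finset (ConIdx K U)) (x : Vec d) : Prop :=
  x ∈ B.knownDomain ∧ ∀ i ∈ I, inner ℝ (B.a i) x = B.α i

/-- `I ∼_t z`, noisy association, through the confidence sets used in round `t`. -/
def NoisyAssoc (B : SafeBandit d K U) (reg δ : ℝ) (x : ℕ → Vec d) (s : ℕ → ConIdx K U → ℝ)
    (t : ℕ) (I : Finset (ConIdx K U)) (z : Vec d) : Prop :=
  z ∈ B.knownDomain ∧ ∀ i ∈ I, ∃ v ∈ B.conf reg δ x s t i, inner ℝ v z = B.α i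

/-- `I` is associated with at least one point. -/
def Consistent (B : SafeBandit d K U) (I : Finset (ConIdx K U)) : Prop := ∃ x, B.Assoc I x

/-! ### Gaps -/

/-- `(π, ρ, σ)` is feasible for the program `Π(v; L, M)`; only the values of `π` on the unknown
part of `L`, of `ρ` on the known part of `L` and of `σ` on `M` matter. -/
def DualFeasible (B : SafeBandit d K U) (v : Vec d) (L M : Finset (ConIdx K U))
    (π ρ σ : ConIdx K U → ℝ) : Prop :=
  (∑ i ∈ L ∩ unknownIdx K U, π i • B.a i + ∑ i ∈ L ∩ knownIdx K U, ρ i • B.a i +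
      ∑ i ∈ M, σ i • B.a i = v) ∧ ∀ i ∈ M, 0 ≤ σ i

/-- The objective of the program `Π(v; L, M)`. -/
def dualValue (B : SafeBandit d K U) (L M : Finset (ConIdx K U))
    (π ρ σ : ConIdx K U → ℝ) : ℝ :=
  ∑ i ∈ L ∩ unknownIdx K U, π i * B.α i + ∑ i ∈ L ∩ knownIdx K U, ρ i * B.α i +
    ∑ i ∈ M, σ i * B.α i

/-- `(π, ρ, σ)` is a minimiser of the program `Π(v; L, M)`. -/
def DualOptimal (B : SafeBandit d K U) (v : Vec d) (L M : Finset (ConIdx K U))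
    (π ρ σ : ConIdx K U → ℝ) : Prop :=
  B.DualFeasible v L M π ρ σ ∧ ∀ π' ρ' σ', B.DualFeasible v L M π' ρ' σ' →
    B.dualValue L M π ρ σ ≤ B.dualValue L M π' ρ' σ'

/-- `spread(v; L, M) = inf (1 + ‖π‖₁)` over the minimisers of `Π(v; L, M)`. It is at least `1`
when there is a minimiser; otherwise the infimum is `+∞` and dividing by it gives `0`, which is
what division by the value `0` of the real `sInf ∅` gives as well. -/
noncomputable def spread (B : SafeBandit d K U) (v : Vec d) (L M : Finset (ConIdx K U)) : ℝ :=
  sInf {c | ∃ π ρ σ, B.DualOptimal v L M π ρ σ ∧ c = 1 + ∑ i ∈ L ∩ unknownIdx K U, |π i|}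

/-- Efficiency separation: how close (from below) the points associated with `I` get to the
optimal value. -/
noncomputable def effSep (B : SafeBandit d K U) (xs : Vec d) (I : Finset (ConIdx K U)) : ℝ :=
  max 0 (sInf {c | ∃ x, B.Assoc I x ∧ c = inner ℝ B.θ (xs - x)})

open Classical in
/-- Efficiency gap `Δ_I` (`0` for inconsistent `I`). -/
noncomputable def effGap (B : SafeBandit d K U) (xs : Vec d) (I : Finset (ConIdx K U)) : ℝ :=
  if B.Consistent I then B.effSep xs I / B.spread B.θ I (knownIdx K U \ I) else 0

/-- Feasibility separation `γ(I; k)`. -/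
noncomputable def feasSep (B : SafeBandit d K U) (I : Finset (ConIdx K U)) (k : ConIdx K U) : ℝ :=
  sInf {c | ∃ x, B.Assoc I x ∧ c = inner ℝ (B.a k) x - B.α k}

open Classical in
/-- Feasibility gap `Γ_I` (`0` for inconsistent `I`). -/
noncomputable def feasGap (B : SafeBandit d K U) (I : Finset (ConIdx K U)) : ℝ :=
  if B.Consistent I then
    ⨆ k : {k : ConIdx K U // k ∉ I},
      B.feasSep I k / B.spread (-(B.a k)) I (knownIdx K U \ insert k.1 I)
  else 0

/-- The points that satisfy the constraints of `I'` with equality, and those of `J'`. -/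
def relaxedSet (B : SafeBandit d K U) (I' J' : Finset (ConIdx K U)) : Set (Vec d) :=
  {x | (∀ i ∈ I', inner ℝ (B.a i) x = B.α i) ∧ ∀ j ∈ J', inner ℝ (B.a j) x ≤ B.α j}

/-- Outer consistency separation. An infimum `-∞` gives `0`, as it should, since the real `sInf`
of a set that is unbounded below is `0`. -/
noncomputable def outerSep (B : SafeBandit d K U) (I' J' : Finset (ConIdx K U))
    (k : ConIdx K U) : ℝ :=
  max 0 (sInf {c | ∃ x ∈ B.relaxedSet I' J', c = inner ℝ (B.a k) x - B.α k})

/-- Inner consistency separation. A supremum `+∞` gives `0`, as it should, since the real `sSup`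
of a set that is unbounded above is `0`. -/
noncomputable def innerSep (B : SafeBandit d K U) (I I' J' : Finset (ConIdx K U))
    (k : ConIdx K U) : ℝ :=
  if k ∈ I then - min 0 (sSup {c | ∃ x ∈ B.relaxedSet I' J', c = inner ℝ (B.a k) x - B.α k})
  else 0

open Classical in
/-- Consistency gap `Λ_I` (`0` for consistent `I`): the maximum over all admissible triples
`(I', J', k)`. -/
noncomputable def consGap (B : SafeBandit d K U) (I : Finset (ConIdx K U)) : ℝ :=
  if B.Consistent I then 0 else
    ⨆ p : {p : Finset (ConIdx K U) × Finset (ConIdx K U) × ConIdx K U //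
        p.1 ⊆ I ∧ p.2.1 ⊆ knownIdx K U \ I ∧ (B.relaxedSet p.1 p.2.1).Nonempty ∧
          p.2.2 ∉ p.1 ∪ p.2.1},
      max (B.outerSep p.1.1 p.1.2.1 p.1.2.2 / B.spread (-(B.a p.1.2.2)) p.1.1 p.1.2.1)
        (B.innerSep I p.1.1 p.1.2.1 p.1.2.2 / B.spread (B.a p.1.2.2) p.1.1 p.1.2.1)

/-- `I` is a suboptimal basic index set: it is not associated with the optimum `xs`. -/
def IsSuboptimalBIS (B : SafeBandit d K U) (xs : Vec d) (I : Finset (ConIdx K U)) : Prop :=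
  B.IsBIS I ∧ ¬ B.Assoc I xs

/-- The gap `Ξ` of the problem: the minimum of `max(Δ_I, Γ_I, Λ_I)` over the suboptimal `I`. -/
noncomputable def gap (B : SafeBandit d K U) (xs : Vec d) : ℝ :=
  ⨅ I : {I : Finset (ConIdx K U) // B.IsSuboptimalBIS xs I},
    max (B.effGap xs I) (max (B.feasGap I) (B.consGap I))

open Classical in
/-- The number of rounds among the first `T` in which the action is noisily associated with some
suboptimal basic index set; whatever `I_t ∼_t x_t` are chosen, it bounds the number of rounds with
`¬ (I_t ∼ x*)`. -/
noncomputable def numBadRounds (B : SafeBandit d K U) (xs : Vec d) (reg δ : ℝ) (x : ℕ → Vec d)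
    (s : ℕ → ConIdx K U → ℝ) (T : ℕ) : ℕ :=
  ((Finset.range T).filter fun t =>
    ∃ I, B.IsSuboptimalBIS xs I ∧ B.NoisyAssoc reg δ x s t I (x t)).card

end SafeBandit

/-! Suppose that every confidence set contains its true parameter in every round. Then the value at
`x_t` of any member of a confidence set is within `w_t = 2 √β ‖x_t‖_{V⁻¹}` of the true value. So if
`I ∼_t x_t`, the action lies on the known hyperplanes of `I`, within `w_t` of the unknown ones,
violates no constraint by more than `w_t`, and by optimism loses at most `w_t` against `x*`
(`IsDOSLBRound.nearlyBasic`).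

The gap turns this into a lower bound on `w_t` by linear programming duality. Let `(π, ρ, σ)`
minimise a program `Π(v; L, J)` that enters the gap. Strong duality gives a point `y` that satisfies
the constraints of `L` and `J` exactly and at which `v` takes the dual value
(`DualOptimal.exists_primal`). Weak duality at `x_t`, with error `w_t` in the unknown equalities,
gives `⟨v, x_t⟩ ≤ ⟨v, y⟩ + w_t ‖π‖₁` (`NearlyIn.inner_le`). One more `w_t` pays for the near
optimality, feasibility or tightness of `x_t`, so each separation is at most `w_t (1 + ‖π‖₁)` and
each quotient by the spread at most `w_t`. Hence `Ξ ≤ w_t` in every bad round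
(`NearlyBasic.gap_le`). Summing `Ξ² ≤ w_t²` gives the count: `∑ ‖x_t‖²_{V⁻¹} = O(d log T)` by the
elliptical potential lemma, and `β` contributes `log((U+1)/δ) + d log T`.

A noisily associated BIS exists because with fewer than `d` constraints noisily tight one could move
from `x_t` both ways along a line inside the permissible set. The same `θ̃` would then be optimal in
its ellipsoid for two different directions, which the strict convexity of the ellipsoid forbids
(`IsDOSLBRound.exists_noisyAssoc`).

The confidence sets are valid with probability `1 - δ` by self-normalised concentration: `(det(λI) /
det V_t)^{1/2} exp(‖S_t‖²_{V_t⁻¹} / 2)` is a supermartingale by the method of mixtures, Ville's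
inequality bounds its running maximum, and a union bound covers the reward and the `U` unknown
constraints. -/

/-! ### Farkas' lemma and systems of linear inequalities. -/

/-- **Farkas' lemma** for finitely many linear functionals on a real vector space. -/
theorem farkas_fin {W : Type*} [AddCommGroup W] [Module ℝ W] :
    ∀ (n : ℕ) (f : Fin n → W →ₗ[ℝ] ℝ) (g : W →ₗ[ℝ] ℝ),
      (∀ z, (∀ i, f i z ≤ 0) → g z ≤ 0) →
      ∃ c : Fin n → ℝ, (∀ i, 0 ≤ c i) ∧ g = ∑ i, c i • f i := by
  intro n
  induction n with
  | zero =>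
    intro f g h
    refine ⟨0, by simp, ?_⟩
    ext z
    have h1 := h z (fun i => i.elim0)
    have h2 := h (-z) (fun i => i.elim0)
    rw [map_neg] at h2
    simp only [Finset.univ_eq_empty, Finset.sum_empty, LinearMap.zero_apply]
    linarith
  | succ n ih =>
    intro f g h
    -- If the last inequality is redundant it gets coefficient `0`. Otherwise some `z` violates only
    -- that one and has `g z > 0`; after scaling `l z = 1`, every functional is projected along `z`
    -- onto those vanishing at `z`.
    by_cases hs : ∀ z, (∀ i : Fin n, f i.castSucc z ≤ 0) → g z ≤ 0
    · obtain ⟨c, hc, hg⟩ := ih (fun i => f i.castSucc) g hs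
      refine ⟨Fin.snoc c 0, ?_, ?_⟩
      · intro i
        refine Fin.lastCases ?_ (fun i => ?_) i
        · simp
        · simpa using hc i
      · rw [Fin.sum_univ_castSucc]
        simpa using hg
    · push Not at hs
      obtain ⟨z₀, hz₀, hgz₀⟩ := hs
      set l := f (Fin.last n) with hldef
      have hl : 0 < l z₀ := by
        by_contra hcon
        refine absurd (h z₀ fun i => ?_) (not_le.mpr hgz₀)
        refine Fin.lastCases ?_ (fun i => ?_) i
        · exact not_lt.mp hcon
        · exact hz₀ i
      obtain ⟨z, hz, hgz, hlz⟩ : ∃ z, (∀ i : Fin n, f i.castSucc z ≤ 0) ∧ 0 < g z ∧ l z = 1 := by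
        refine ⟨(l z₀)⁻¹ • z₀, fun i => ?_, ?_, ?_⟩
        · rw [map_smul, smul_eq_mul]
          exact mul_nonpos_of_nonneg_of_nonpos (inv_pos.mpr hl).le (hz₀ i)
        · rw [map_smul, smul_eq_mul]
          exact mul_pos (inv_pos.mpr hl) hgz₀
        · rw [map_smul, smul_eq_mul, inv_mul_cancel₀ hl.ne']
      obtain ⟨c, hc, hg⟩ := ih (fun i => f i.castSucc - f i.castSucc z • l) (g - g z • l) (by
        intro y hy
        -- The shifted point `y - l y • z` lies in `ker l`, so the last inequality holds there for
        -- free.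
        have key := h (y - l y • z) (fun i => by
          refine Fin.lastCases ?_ (fun i => ?_) i
          · simp [← hldef, hlz]
          · have := hy i
            simp only [LinearMap.sub_apply, LinearMap.smul_apply, smul_eq_mul] at this
            simp only [map_sub, map_smul, smul_eq_mul]
            linarith)
        simp only [map_sub, map_smul, smul_eq_mul] at key
        simp only [LinearMap.sub_apply, LinearMap.smul_apply, smul_eq_mul]
        linarith)
      refine ⟨Fin.snoc c (g z - ∑ i, c i * f i.castSucc z), ?_, ?_⟩
      · intro i
        refine Fin.lastCases ?_ (fun i => ?_) i
        · simp only [Fin.snoc_last]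
          have : ∑ i, c i * f i.castSucc z ≤ 0 :=
            Finset.sum_nonpos fun i _ => mul_nonpos_of_nonneg_of_nonpos (hc i) (hz i)
          linarith
        · simpa using hc i
      · ext y
        have hy := congrArg (fun φ : W →ₗ[ℝ] ℝ => φ y) hg
        simp only [LinearMap.sub_apply, LinearMap.smul_apply, smul_eq_mul, LinearMap.sum_apply,
          mul_sub, Finset.sum_sub_distrib] at hy
        rw [Fin.sum_univ_castSucc]
        simp only [LinearMap.add_apply, LinearMap.smul_apply, smul_eq_mul, LinearMap.sum_apply,
          Fin.snoc_castSucc, Fin.snoc_last, ← hldef, sub_mul, Finset.sum_mul]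
        simp only [← mul_assoc] at hy
        linarith

theorem farkas_fintype {W ι : Type*} [AddCommGroup W] [Module ℝ W] [Fintype ι]
    (f : ι → W →ₗ[ℝ] ℝ) (g : W →ₗ[ℝ] ℝ) (h : ∀ z, (∀ i, f i z ≤ 0) → g z ≤ 0) :
    ∃ c : ι → ℝ, (∀ i, 0 ≤ c i) ∧ g = ∑ i, c i • f i := by
  let e := Fintype.equivFin ι
  obtain ⟨c, hc, hg⟩ := farkas_fin _ (fun i => f (e.symm i)) g fun z hz =>
    h z fun i => by simpa using hz (e i)
  refine ⟨fun i => c (e i), fun i => hc _, ?_⟩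
  rw [hg, ← e.sum_comp]
  simp

/-- Solvability of a finite system of linear inequalities (`i ∈ P`) and equalities (`i ∉ P`), as a
theorem of the alternative; `l` is the vector of slacks. -/
theorem exists_solution_of_nonneg_on_relations {ι : Type*} [Fintype ι] [DecidableEq ι] {d : ℕ}
    (a : ι → Vec d) (α : ι → ℝ) (P : Set ι)
    (h : ∀ c : ι → ℝ, ∑ i, c i • a i = 0 → (∀ i ∈ P, 0 ≤ c i) → 0 ≤ ∑ i, c i * α i) :
    ∃ (y : Vec d) (l : ι → ℝ), (∀ i, α i = inner ℝ (a i) y + l i) ∧ (∀ i, 0 ≤ l i) ∧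
      ∀ i, i ∉ P → l i = 0 := by
  classical
  let F : Fin d → (ι → ℝ) →ₗ[ℝ] ℝ := fun k => ∑ i, a i k • LinearMap.proj i
  have hF : ∀ k c, F k c = ∑ i, a i k * c i := fun k c => by simp [F]
  let f : (Fin d ⊕ Fin d) ⊕ P → (ι → ℝ) →ₗ[ℝ] ℝ :=
    Sum.elim (Sum.elim F (fun k => -F k)) fun i => -LinearMap.proj (i : ι)
  -- Farkas is applied in the space of coefficient vectors `c`. The multipliers of the two signs of
  -- each coordinate equation combine into the coordinates of `y`; those of the sign conditions on
  -- `P` are the slacks.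
  obtain ⟨w, hw, hg⟩ := farkas_fintype f (-∑ i, α i • LinearMap.proj i) (by
    intro z hz
    have := h z (by
        ext k
        have h1 := hz (Sum.inl (Sum.inl k))
        have h2 := hz (Sum.inl (Sum.inr k))
        simp only [f, Sum.elim_inl, Sum.elim_inr, LinearMap.neg_apply, hF] at h1 h2
        have : ∑ i, a i k * z i = 0 := by linarith
        simp only [WithLp.ofLp_sum, WithLp.ofLp_smul, Finset.sum_apply, Pi.smul_apply, smul_eq_mul]
        simpa [mul_comm] using this)
      (fun i hi => by
        have := hz (Sum.inr ⟨i, hi⟩)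
        simpa [f] using this)
    simpa [mul_comm] using this)
  refine ⟨WithLp.toLp 2 fun k => w (Sum.inl (Sum.inr k)) - w (Sum.inl (Sum.inl k)),
    fun i => if hi : i ∈ P then w (Sum.inr ⟨i, hi⟩) else 0, fun i => ?_, fun i => ?_,
    fun i hi => by simp [hi]⟩
  · have := congrArg (fun φ : (ι → ℝ) →ₗ[ℝ] ℝ => φ (Pi.single i 1)) hg
    simp only [LinearMap.neg_apply, LinearMap.add_apply, LinearMap.sum_apply,
      LinearMap.smul_apply, smul_eq_mul, LinearMap.proj_apply, Fintype.sum_sum_type, f,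
      Sum.elim_inl, Sum.elim_inr, hF, Pi.single_apply, mul_ite, mul_one, mul_zero,
      Finset.sum_ite_eq', Finset.mem_univ, if_true] at this
    have hP : ∑ x : P, w (Sum.inr x) * -(if (x : ι) = i then (1 : ℝ) else 0) =
        -(if hi : i ∈ P then w (Sum.inr ⟨i, hi⟩) else 0) := by
      by_cases hi : i ∈ P
      · rw [Finset.sum_eq_single ⟨i, hi⟩]
        · simp [hi]
        · intro b _ hb
          have : (b : ι) ≠ i := fun hbi => hb (Subtype.ext hbi)
          simp [this]
        · simp
      · rw [Finset.sum_eq_zero]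
        · simp [hi]
        · intro b _
          have : (b : ι) ≠ i := fun hbi => hi (hbi ▸ b.2)
          simp [this]
    rw [hP] at this
    rw [PiLp.inner_apply]
    simp only [RCLike.inner_apply, conj_trivial, sub_mul, Finset.sum_sub_distrib]
    simp only [mul_neg, Finset.sum_neg_distrib] at this
    linarith
  · by_cases hi : i ∈ P
    · simpa [hi] using hw _
    · simp [hi]

/-! ### Duality for the programs `Π`, and the gap as a lower bound for the confidence width. -/

namespace SafeBandit

variable {d K U : ℕ}

theorem mem_knownIdx {i : ConIdx K U} : i ∈ knownIdx K U ↔ i.isLeft = true := by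
  simp [knownIdx]

theorem sum_inter_unknown_add_known {E : Type*} [AddCommMonoid E] (L : Finset (ConIdx K U))
    (f : ConIdx K U → E) :
    ∑ i ∈ L ∩ unknownIdx K U, f i + ∑ i ∈ L ∩ knownIdx K U, f i = ∑ i ∈ L, f i := by
  classical
  rw [← Finset.sum_union]
  · congr 1
    ext i
    rcases i with i | i <;> simp [knownIdx, unknownIdx]
  · rw [Finset.disjoint_left]
    rintro (i | i) <;> simp [knownIdx, unknownIdx]

/-- Strong duality with complementary slackness: a minimiser of `Π(v; L, M)` has the same value as
some point of the primal feasible set. -/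
theorem DualOptimal.exists_primal {B : SafeBandit d K U} {v : Vec d} {L M : Finset (ConIdx K U)}
    {π ρ σ : ConIdx K U → ℝ} (h : B.DualOptimal v L M π ρ σ) (hLM : Disjoint L M) :
    ∃ y ∈ B.relaxedSet L M, inner ℝ v y = B.dualValue L M π ρ σ := by
  classical
  obtain ⟨⟨hv, hσ⟩, hmin⟩ := h
  -- `ind` replaces the constraints outside `L ∪ M` by `0 = 0`. Slack is allowed only on `P`, where
  -- `σ` vanishes: this is complementary slackness, and it makes the primal value equal to the dual
  -- one.
  let ind : ConIdx K U → ℝ := fun i => if i ∈ L ∪ M then 1 else 0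
  let P : Set (ConIdx K U) := {i | i ∈ M ∧ σ i = 0}
  have hsplitE : ∀ c : ConIdx K U → ℝ, ∑ i, c i • ind i • B.a i =
      ∑ i ∈ L, c i • B.a i + ∑ i ∈ M, c i • B.a i := by
    intro c
    rw [← Finset.sum_union hLM, ← Finset.sum_subset (Finset.subset_univ (L ∪ M))]
    · exact Finset.sum_congr rfl fun i hi => by simp only [ind, if_pos hi, one_smul]
    · intro i _ hi
      simp only [ind, if_neg hi, zero_smul, smul_zero]
  have hsplitR : ∀ c : ConIdx K U → ℝ, ∑ i, c i * (ind i * B.α i) =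
      ∑ i ∈ L, c i * B.α i + ∑ i ∈ M, c i * B.α i := by
    intro c
    rw [← Finset.sum_union hLM, ← Finset.sum_subset (Finset.subset_univ (L ∪ M))]
    · exact Finset.sum_congr rfl fun i hi => by simp only [ind, if_pos hi, one_mul]
    · intro i _ hi
      simp only [ind, if_neg hi, zero_mul, mul_zero]
  obtain ⟨y, l, hy, hl, hlP⟩ := exists_solution_of_nonneg_on_relations
    (fun i => ind i • B.a i) (fun i => ind i * B.α i) P (by
    intro c hc hcP
    rw [hsplitE] at hc
    rw [hsplitR]
    -- A linear relation `c` that is nonnegative on `P` is a feasible direction at the minimiser, so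
    -- a small step along it cannot lower the objective.
    obtain ⟨ε, hε, hεσ⟩ : ∃ ε > 0, ∀ i ∈ M, 0 ≤ σ i + ε * c i := by
      have : ∀ i ∈ M, ∀ᶠ ε in nhdsWithin (0 : ℝ) (Set.Ioi 0), 0 ≤ σ i + ε * c i := by
        intro i hi
        rcases (hσ i hi).eq_or_lt with h0 | h0
        · filter_upwards [self_mem_nhdsWithin] with ε hε
          rw [← h0, zero_add]
          exact mul_nonneg (le_of_lt hε) (hcP i ⟨hi, h0.symm⟩)
        · have ht : Filter.Tendsto (fun ε : ℝ => σ i + ε * c i) (nhds 0) (nhds (σ i + 0 * c i)) :=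
            Continuous.tendsto (by fun_prop) 0
          rw [zero_mul, add_zero] at ht
          exact ((ht.mono_left nhdsWithin_le_nhds).eventually (lt_mem_nhds h0)).mono
            fun _ h => le_of_lt h
      have h2 := ((Finset.eventually_all M).2 this).and self_mem_nhdsWithin
      obtain ⟨ε, h3, h4⟩ := h2.exists
      exact ⟨ε, h4, h3⟩
    have hfe : B.DualFeasible v L M (fun i => π i + ε * c i) (fun i => ρ i + ε * c i)
        (fun i => σ i + ε * c i) := by
      refine ⟨?_, hεσ⟩
      rw [← sum_inter_unknown_add_known L (fun i => c i • B.a i)] at hc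
      simp only [add_smul, Finset.sum_add_distrib, mul_smul, ← Finset.smul_sum]
      rw [← add_zero v, ← hv, ← smul_zero ε, ← hc, smul_add, smul_add]
      abel
    have := hmin _ _ _ hfe
    rw [← sum_inter_unknown_add_known L (fun i => c i * B.α i)]
    simp only [dualValue, add_mul, Finset.sum_add_distrib, mul_assoc, ← Finset.mul_sum] at this
    by_contra hcon
    push Not at hcon
    nlinarith [mul_neg_of_pos_of_neg hε hcon])
  have hyL : ∀ i ∈ L, inner ℝ (B.a i) y = B.α i := by
    intro i hi
    have h1 := hy i
    rw [hlP i (fun h => Finset.disjoint_left.mp hLM hi h.1)] at h1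
    simpa [ind, hi] using h1.symm
  have hyM : ∀ i ∈ M, B.α i = inner ℝ (B.a i) y + l i := by
    intro i hi
    simpa [ind, hi] using hy i
  refine ⟨y, ⟨hyL, fun j hj => by linarith [hyM j hj, hl j]⟩, ?_⟩
  rw [← hv, dualValue, inner_add_left, inner_add_left, sum_inner, sum_inner, sum_inner]
  simp only [real_inner_smul_left]
  congr 1
  · congr 1
    · exact Finset.sum_congr rfl fun i hi => by rw [hyL i (Finset.mem_inter.mp hi).1]
    · exact Finset.sum_congr rfl fun i hi => by rw [hyL i (Finset.mem_inter.mp hi).1]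
  · refine Finset.sum_congr rfl fun i hi => ?_
    by_cases h0 : σ i = 0
    · simp [h0]
    · rw [hyM i hi, hlP i (fun h => h0 h.2), add_zero]

theorem spread_nonneg (B : SafeBandit d K U) (v : Vec d) (L M : Finset (ConIdx K U)) :
    0 ≤ B.spread v L M := by
  refine Real.sInf_nonneg ?_
  rintro c ⟨π, ρ, σ, -, rfl⟩
  positivity

/-- A quotient by the spread is at most `b` as soon as the numerator is at most `b` times the
objective `1 + ‖π‖₁` of every minimiser. -/
theorem div_spread_le {B : SafeBandit d K U} {v : Vec d} {L M : Finset (ConIdx K U)} {n b : ℝ}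
    (hb : 0 ≤ b)
    (h : ∀ π ρ σ, B.DualOptimal v L M π ρ σ →
      n ≤ b * (1 + ∑ i ∈ L ∩ unknownIdx K U, |π i|)) :
    n / B.spread v L M ≤ b := by
  -- Spread `0` occurs only as the default when there is no minimiser, and the quotient is then `0`.
  rcases (B.spread_nonneg v L M).eq_or_lt with h0 | h0
  · rw [← h0, div_zero]
    exact hb
  · rw [div_le_iff₀ h0]
    rcases hb.eq_or_lt with rfl | hb'
    · obtain ⟨c, π, ρ, σ, ho, -⟩ : {c | ∃ π ρ σ, B.DualOptimal v L M π ρ σ ∧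
          c = 1 + ∑ i ∈ L ∩ unknownIdx K U, |π i|}.Nonempty := by
        by_contra hne
        rw [Set.not_nonempty_iff_eq_empty] at hne
        rw [spread, hne, Real.sInf_empty] at h0
        exact lt_irrefl _ h0
      simpa using h π ρ σ ho
    · rw [mul_comm, ← div_le_iff₀ hb']
      refine le_csInf ?_ ?_
      · by_contra hne
        rw [Set.not_nonempty_iff_eq_empty] at hne
        rw [spread, hne, Real.sInf_empty] at h0
        exact lt_irrefl _ h0
      · rintro c ⟨π, ρ, σ, ho, rfl⟩
        rw [div_le_iff₀ hb', mul_comm]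
        exact h π ρ σ ho

/-- The point `x` satisfies the constraints of `L` with equality and those of `M`, up to an error
`w` in the unknown constraints of `L`. -/
structure NearlyIn (B : SafeBandit d K U) (w : ℝ) (L M : Finset (ConIdx K U)) (x : Vec d) :
    Prop where
  unknown : ∀ i ∈ L ∩ unknownIdx K U, |inner ℝ (B.a i) x - B.α i| ≤ w
  known : ∀ i ∈ L ∩ knownIdx K U, inner ℝ (B.a i) x = B.α i
  relaxed : ∀ i ∈ M, inner ℝ (B.a i) x ≤ B.α i

/-- Weak duality with errors: the multipliers `π` have no sign, so each unknown equality costs up to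
`w |π i|`. Known equalities cost nothing, and `σ ≥ 0` gives the right sign on `M`. -/
theorem NearlyIn.inner_le {B : SafeBandit d K U} {w : ℝ} {L M : Finset (ConIdx K U)} {x v : Vec d}
    {π ρ σ : ConIdx K U → ℝ} (hx : B.NearlyIn w L M x) (h : B.DualFeasible v L M π ρ σ) :
    inner ℝ v x ≤ B.dualValue L M π ρ σ + w * ∑ i ∈ L ∩ unknownIdx K U, |π i| := by
  rw [← h.1, inner_add_left, inner_add_left, sum_inner, sum_inner, sum_inner]
  simp only [real_inner_smul_left, dualValue]
  have h1 : ∑ i ∈ L ∩ unknownIdx K U, π i * inner ℝ (B.a i) x ≤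
      ∑ i ∈ L ∩ unknownIdx K U, π i * B.α i + w * ∑ i ∈ L ∩ unknownIdx K U, |π i| := by
    rw [Finset.mul_sum, ← Finset.sum_add_distrib]
    refine Finset.sum_le_sum fun i hi => ?_
    have h2 : π i * (inner ℝ (B.a i) x - B.α i) ≤ |π i| * w :=
      (le_abs_self _).trans (by
        rw [abs_mul]
        exact mul_le_mul_of_nonneg_left (hx.unknown i hi) (abs_nonneg _))
    linarith
  have h2 : ∑ i ∈ L ∩ knownIdx K U, ρ i * inner ℝ (B.a i) x =
      ∑ i ∈ L ∩ knownIdx K U, ρ i * B.α i :=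
    Finset.sum_congr rfl fun i hi => by rw [hx.known i hi]
  have h3 : ∑ i ∈ M, σ i * inner ℝ (B.a i) x ≤ ∑ i ∈ M, σ i * B.α i :=
    Finset.sum_le_sum fun i hi => mul_le_mul_of_nonneg_left (hx.relaxed i hi) (h.2 i hi)
  linarith

/-- Some point of the relaxed set is, in direction `v`, at most `w ‖π‖₁` worse than `x`. -/
theorem NearlyIn.exists_relaxedSet {B : SafeBandit d K U} {w : ℝ} {L M : Finset (ConIdx K U)}
    {x v : Vec d} {π ρ σ : ConIdx K U → ℝ} (hx : B.NearlyIn w L M x) (hLM : Disjoint L M)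
    (h : B.DualOptimal v L M π ρ σ) :
    ∃ y ∈ B.relaxedSet L M,
      inner ℝ v x ≤ inner ℝ v y + w * ∑ i ∈ L ∩ unknownIdx K U, |π i| := by
  obtain ⟨y, hy, hvy⟩ := h.exists_primal hLM
  exact ⟨y, hy, hvy ▸ hx.inner_le h.1⟩

theorem assoc_of_mem_relaxedSet {B : SafeBandit d K U} {I : Finset (ConIdx K U)} {y : Vec d}
    (hy : y ∈ B.relaxedSet I (knownIdx K U \ I)) : B.Assoc I y := by
  refine ⟨fun i => ?_, hy.1⟩
  by_cases hi : Sum.inl i ∈ I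
  · exact (hy.1 _ hi).le
  · exact hy.2 _ (by simp [mem_knownIdx, hi])

/-- Supplies the bounds below without which a real `sInf` over associated points would take its
default value. -/
theorem abs_inner_le_of_assoc {B : SafeBandit d K U}
    (hK : B.knownDomain ⊆ Metric.closedBall 0 1) {I : Finset (ConIdx K U)} {y : Vec d}
    (hy : B.Assoc I y) (v : Vec d) : |inner ℝ v y| ≤ ‖v‖ := by
  have h1 : ‖y‖ ≤ 1 := by simpa using hK hy.1
  calc |inner ℝ v y| ≤ ‖v‖ * ‖y‖ := abs_real_inner_le_norm v y
    _ ≤ ‖v‖ * 1 := by gcongr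
    _ = ‖v‖ := mul_one _

/-- What confidence sets of width `w` say about the action `x`: it is nearly on the hyperplanes of
`I`, satisfies the known constraints, and is nearly feasible and nearly optimal. -/
structure NearlyBasic (B : SafeBandit d K U) (xs : Vec d) (w : ℝ) (I : Finset (ConIdx K U))
    (x : Vec d) : Prop where
  nonneg : 0 ≤ w
  mem : x ∈ B.knownDomain
  unknown : ∀ i ∈ I, |inner ℝ (B.a i) x - B.α i| ≤ w
  known : ∀ i ∈ I ∩ knownIdx K U, inner ℝ (B.a i) x = B.α i
  feasible : ∀ i, inner ℝ (B.a i) x ≤ B.α i + w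
  optimal : inner ℝ B.θ xs ≤ inner ℝ B.θ x + w

namespace NearlyBasic

variable {B : SafeBandit d K U} {xs x : Vec d} {w : ℝ} {I : Finset (ConIdx K U)}

theorem nearlyIn (h : B.NearlyBasic xs w I x) {L M : Finset (ConIdx K U)} (hL : L ⊆ I)
    (hM : M ⊆ knownIdx K U \ I) : B.NearlyIn w L M x where
  unknown i hi := h.unknown i (hL (Finset.mem_inter.mp hi).1)
  known i hi := h.known i (Finset.inter_subset_inter_right hL hi)
  relaxed i hi := by
    have h1 := (Finset.mem_sdiff.mp (hM hi)).1
    rcases i with i | i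
    · exact h.mem i
    · simp [mem_knownIdx] at h1

/-- Duality for `v = θ` yields an associated `y` with `⟨θ, x⟩ ≤ ⟨θ, y⟩ + w ‖π‖₁`, and near
optimality of `x` adds one more `w`. -/
theorem effGap_le (h : B.NearlyBasic xs w I x) (hK : B.knownDomain ⊆ Metric.closedBall 0 1) :
    B.effGap xs I ≤ w := by
  unfold effGap
  split_ifs with hI
  swap
  · exact h.nonneg
  refine div_spread_le h.nonneg fun π ρ σ ho => ?_
  obtain ⟨y, hy, hxy⟩ := (h.nearlyIn subset_rfl subset_rfl).exists_relaxedSet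
    Finset.disjoint_sdiff ho
  have hS : 0 ≤ ∑ i ∈ I ∩ unknownIdx K U, |π i| := Finset.sum_nonneg fun i _ => abs_nonneg _
  refine max_le (mul_nonneg h.nonneg (by linarith)) ?_
  have hbdd : BddBelow {c | ∃ x, B.Assoc I x ∧ c = inner ℝ B.θ (xs - x)} := by
    refine ⟨inner ℝ B.θ xs - ‖B.θ‖, ?_⟩
    rintro c ⟨z, hz, rfl⟩
    rw [inner_sub_right]
    linarith [(le_abs_self _).trans (abs_inner_le_of_assoc hK hz B.θ)]
  refine (csInf_le hbdd ⟨y, assoc_of_mem_relaxedSet hy, rfl⟩).trans ?_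
  rw [inner_sub_right]
  linarith [h.optimal]

/-- For unknown `k` this is duality with `v = -a k`, plus `w` for the near feasibility of `x`. A
known `k` contributes nothing positive, since associated points lie in the known domain. -/
theorem feasGap_le (h : B.NearlyBasic xs w I x) (hK : B.knownDomain ⊆ Metric.closedBall 0 1) :
    B.feasGap I ≤ w := by
  unfold feasGap
  split_ifs with hI
  swap
  · exact h.nonneg
  refine Real.iSup_le (fun ⟨k, hk⟩ => ?_) h.nonneg
  have hbdd : BddBelow {c | ∃ x, B.Assoc I x ∧ c = inner ℝ (B.a k) x - B.α k} := by
    refine ⟨-‖B.a k‖ - B.α k, ?_⟩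
    rintro c ⟨z, hz, rfl⟩
    linarith [(abs_le.mp (abs_inner_le_of_assoc hK hz (B.a k))).1]
  rcases k with k | k
  · refine le_trans (div_nonpos_of_nonpos_of_nonneg ?_ (B.spread_nonneg _ _ _)) h.nonneg
    obtain ⟨z, hz⟩ := hI
    refine (csInf_le hbdd ⟨z, hz, rfl⟩).trans ?_
    linarith [hz.1 k]
  · have hins : knownIdx K U \ insert (Sum.inr k) I = knownIdx K U \ I := by
      ext i
      rcases i with i | i <;> simp [mem_knownIdx]
    simp only [hins]
    refine div_spread_le h.nonneg fun π ρ σ ho => ?_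
    obtain ⟨y, hy, hxy⟩ := (h.nearlyIn subset_rfl subset_rfl).exists_relaxedSet
      Finset.disjoint_sdiff ho
    refine (csInf_le hbdd ⟨y, assoc_of_mem_relaxedSet hy, rfl⟩).trans ?_
    rw [inner_neg_left, inner_neg_left] at hxy
    linarith [h.feasible (Sum.inr k)]

/-- The outer quotient uses `v = -a k` and near feasibility in constraint `k`. The inner one uses `v
= a k` and near tightness, available only for `k ∈ I`. Unbounded sets give separation `0`. -/
theorem consGap_le (h : B.NearlyBasic xs w I x) : B.consGap I ≤ w := by
  unfold consGap
  split_ifs with hI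
  · exact h.nonneg
  refine Real.iSup_le (fun p => ?_) h.nonneg
  obtain ⟨⟨L, M, k⟩, hL, hM, -, -⟩ := p
  dsimp only at hL hM ⊢
  have hLM : Disjoint L M :=
    Finset.disjoint_of_subset_left hL (Finset.disjoint_of_subset_right hM Finset.disjoint_sdiff)
  refine max_le ?_ ?_
  · refine div_spread_le h.nonneg fun π ρ σ ho => ?_
    obtain ⟨y, hy, hxy⟩ := (h.nearlyIn hL hM).exists_relaxedSet hLM ho
    have hS : 0 ≤ ∑ i ∈ L ∩ unknownIdx K U, |π i| := Finset.sum_nonneg fun i _ => abs_nonneg _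
    have hb : 0 ≤ w * (1 + ∑ i ∈ L ∩ unknownIdx K U, |π i|) :=
      mul_nonneg h.nonneg (by linarith)
    refine max_le hb ?_
    by_cases hbdd : BddBelow {c | ∃ x ∈ B.relaxedSet L M, c = inner ℝ (B.a k) x - B.α k}
    · refine (csInf_le hbdd ⟨y, hy, rfl⟩).trans ?_
      rw [inner_neg_left, inner_neg_left] at hxy
      linarith [h.feasible k]
    · rwa [Real.sInf_of_not_bddBelow hbdd]
  · refine div_spread_le h.nonneg fun π ρ σ ho => ?_
    have hS : 0 ≤ ∑ i ∈ L ∩ unknownIdx K U, |π i| := Finset.sum_nonneg fun i _ => abs_nonneg _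
    have hb : 0 ≤ w * (1 + ∑ i ∈ L ∩ unknownIdx K U, |π i|) :=
      mul_nonneg h.nonneg (by linarith)
    unfold innerSep
    split_ifs with hk
    swap
    · exact hb
    rw [neg_le]
    refine le_min (by linarith) ?_
    obtain ⟨y, hy, hxy⟩ := (h.nearlyIn hL hM).exists_relaxedSet hLM ho
    by_cases hbdd : BddAbove {c | ∃ x ∈ B.relaxedSet L M, c = inner ℝ (B.a k) x - B.α k}
    · refine le_trans ?_ (le_csSup hbdd ⟨y, hy, rfl⟩)
      linarith [(abs_le.mp (h.unknown k hk)).1]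
    · rw [Real.sSup_of_not_bddAbove hbdd]
      linarith

theorem gap_le (h : B.NearlyBasic xs w I x) (hK : B.knownDomain ⊆ Metric.closedBall 0 1)
    (hI : B.IsSuboptimalBIS xs I) : B.gap xs ≤ w := by
  refine (ciInf_le (Set.finite_range _).bddBelow
    (⟨I, hI⟩ : {I : Finset (ConIdx K U) // B.IsSuboptimalBIS xs I})).trans ?_
  exact max_le (h.effGap_le hK) (max_le (h.feasGap_le hK) h.consGap_le)

end NearlyBasic

theorem gap_nonneg (B : SafeBandit d K U) (xs : Vec d) : 0 ≤ B.gap xs := by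
  refine Real.iInf_nonneg fun I => le_max_of_le_left ?_
  unfold effGap
  split_ifs
  · exact div_nonneg (le_max_left _ _) (B.spread_nonneg _ _ _)
  · exact le_rfl

end SafeBandit

/-! ### Quadratic forms, rank one updates and determinants. -/

namespace Matrix

open Matrix

variable {n : Type*} [Fintype n]

theorem PosSemidef.dotProduct_mulVec_self_nonneg {V : Matrix n n ℝ} (hV : V.PosSemidef)
    (u : n → ℝ) : 0 ≤ u ⬝ᵥ V *ᵥ u := by
  simpa using hV.dotProduct_mulVec_nonneg u

theorem IsHermitian.dotProduct_mulVec_comm {V : Matrix n n ℝ} (hV : V.IsHermitian)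
    (u w : n → ℝ) : u ⬝ᵥ V *ᵥ w = w ⬝ᵥ V *ᵥ u := by
  have hT : Vᵀ = V := by simpa using hV.eq
  rw [dotProduct_mulVec, ← mulVec_transpose, hT, dotProduct_comm]

/-- Cauchy-Schwarz for the bilinear form of a positive semidefinite matrix. -/
theorem PosSemidef.sq_dotProduct_mulVec_le {V : Matrix n n ℝ} (hV : V.PosSemidef)
    (u w : n → ℝ) : (u ⬝ᵥ V *ᵥ w) ^ 2 ≤ (u ⬝ᵥ V *ᵥ u) * (w ⬝ᵥ V *ᵥ w) := by
  have h : ∀ t : ℝ, 0 ≤ (w ⬝ᵥ V *ᵥ w) * (t * t) + (2 * (u ⬝ᵥ V *ᵥ w)) * t + u ⬝ᵥ V *ᵥ u := by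
    intro t
    have := hV.dotProduct_mulVec_self_nonneg (u + t • w)
    simp only [mulVec_add, mulVec_smul, dotProduct_add, add_dotProduct, smul_dotProduct,
      dotProduct_smul, smul_eq_mul, hV.isHermitian.dotProduct_mulVec_comm w u] at this
    linarith
  have := discrim_le_zero h
  rw [discrim] at this
  linarith

theorem PosSemidef.sqrt_dotProduct_mulVec_add_le {V : Matrix n n ℝ} (hV : V.PosSemidef)
    (u w : n → ℝ) :
    √((u + w) ⬝ᵥ V *ᵥ (u + w)) ≤ √(u ⬝ᵥ V *ᵥ u) + √(w ⬝ᵥ V *ᵥ w) := by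
  have hu := hV.dotProduct_mulVec_self_nonneg u
  have hw := hV.dotProduct_mulVec_self_nonneg w
  refine Real.sqrt_le_iff.mpr ⟨by positivity, ?_⟩
  have h1 : u ⬝ᵥ V *ᵥ w ≤ √(u ⬝ᵥ V *ᵥ u) * √(w ⬝ᵥ V *ᵥ w) := by
    rw [← Real.sqrt_mul hu]
    exact Real.le_sqrt_of_sq_le (hV.sq_dotProduct_mulVec_le u w)
  simp only [mulVec_add, dotProduct_add, add_dotProduct,
    hV.isHermitian.dotProduct_mulVec_comm w u]
  nlinarith [Real.sq_sqrt hu, Real.sq_sqrt hw]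

variable [DecidableEq n]

theorem PosDef.mulVec_inv_mulVec {V : Matrix n n ℝ} (hV : V.PosDef) (u : n → ℝ) :
    V *ᵥ (V⁻¹ *ᵥ u) = u := by
  rw [mulVec_mulVec, mul_nonsing_inv _ hV.det_pos.ne'.isUnit, one_mulVec]

theorem PosDef.inv_mulVec_mulVec {V : Matrix n n ℝ} (hV : V.PosDef) (u : n → ℝ) :
    V⁻¹ *ᵥ (V *ᵥ u) = u := by
  rw [mulVec_mulVec, nonsing_inv_mul _ hV.det_pos.ne'.isUnit, one_mulVec]

theorem PosDef.sq_dotProduct_le {V : Matrix n n ℝ} (hV : V.PosDef) (u w : n → ℝ) :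
    (u ⬝ᵥ w) ^ 2 ≤ (u ⬝ᵥ V *ᵥ u) * (w ⬝ᵥ V⁻¹ *ᵥ w) := by
  have := hV.posSemidef.sq_dotProduct_mulVec_le u (V⁻¹ *ᵥ w)
  rwa [hV.mulVec_inv_mulVec, dotProduct_comm (V⁻¹ *ᵥ w)] at this

omit [DecidableEq n] in
theorem PosDef.add_vecMulVec_self {V : Matrix n n ℝ} (hV : V.PosDef) (x : n → ℝ) :
    (V + vecMulVec x x).PosDef :=
  hV.add_posSemidef (by simpa using posSemidef_vecMulVec_self_star x)

theorem det_add_vecMulVec_self {V : Matrix n n ℝ} (hV : V.PosDef) (x : n → ℝ) :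
    (V + vecMulVec x x).det = V.det * (1 + x ⬝ᵥ V⁻¹ *ᵥ x) := by
  rw [vecMulVec_eq Unit, det_add_replicateCol_mul_replicateRow hV.det_pos.ne'.isUnit]
  rw [← replicateRow_vecMul, replicateRow_mul_replicateCol,
    det_unique (n := Unit)]
  change V.det * (1 + x ᵥ* V⁻¹ ⬝ᵥ x) = _
  rw [dotProduct_mulVec]

/-- The quadratic form of the inverse after a rank one update. -/
theorem PosDef.dotProduct_inv_add_vecMulVec {V : Matrix n n ℝ} (hV : V.PosDef) (x s : n → ℝ)
    (η : ℝ) :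
    (s + η • x) ⬝ᵥ (V + vecMulVec x x)⁻¹ *ᵥ (s + η • x) = s ⬝ᵥ V⁻¹ *ᵥ s +
      (2 * η * (x ⬝ᵥ V⁻¹ *ᵥ s) + η ^ 2 * (x ⬝ᵥ V⁻¹ *ᵥ x) - (x ⬝ᵥ V⁻¹ *ᵥ s) ^ 2) /
        (1 + x ⬝ᵥ V⁻¹ *ᵥ x) := by
  have hq : 0 ≤ x ⬝ᵥ V⁻¹ *ᵥ x := hV.inv.posSemidef.dotProduct_mulVec_self_nonneg x
  have hc := hV.inv.isHermitian.dotProduct_mulVec_comm s x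
  set q := x ⬝ᵥ V⁻¹ *ᵥ x
  set p := x ⬝ᵥ V⁻¹ *ᵥ s
  -- The vector in brackets is the Sherman–Morrison solution of `(V + x xᵀ) z = s + η x`; verifying
  -- it avoids a formula for the inverse matrix.
  have hw : (V + vecMulVec x x) *ᵥ (V⁻¹ *ᵥ s + ((η - p) / (1 + q)) • V⁻¹ *ᵥ x) =
      s + η • x := by
    rw [add_mulVec, mulVec_add, mulVec_smul, hV.mulVec_inv_mulVec, hV.mulVec_inv_mulVec,
      vecMulVec_mulVec, dotProduct_add, dotProduct_smul]
    ext i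
    simp only [Pi.add_apply, Pi.smul_apply, smul_eq_mul, MulOpposite.smul_eq_mul_unop,
      MulOpposite.unop_op]
    change s i + (η - p) / (1 + q) * x i + x i * (p + (η - p) / (1 + q) * q) = s i + η * x i
    field_simp
    ring
  have hw' := congrArg (fun z => (V + vecMulVec x x)⁻¹ *ᵥ z) hw
  simp only [(hV.add_vecMulVec_self x).inv_mulVec_mulVec] at hw'
  rw [← hw', dotProduct_add, dotProduct_smul, add_dotProduct, add_dotProduct, smul_dotProduct,
    smul_dotProduct]
  change s ⬝ᵥ V⁻¹ *ᵥ s + η • p + ((η - p) / (1 + q)) • (s ⬝ᵥ V⁻¹ *ᵥ x + η • q) = _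
  rw [hc]
  simp only [smul_eq_mul]
  field_simp
  ring

theorem sq_dotProduct_le_dotProduct_self_mul (u w : n → ℝ) :
    (u ⬝ᵥ w) ^ 2 ≤ (u ⬝ᵥ u) * (w ⬝ᵥ w) := by
  have := (PosSemidef.one (n := n) (R := ℝ)).sq_dotProduct_mulVec_le u w
  simpa using this

/-- Taking `u = V⁻¹ x` in `h` and combining with Cauchy–Schwarz gives `c q² ≤ ‖x‖² q` for the
left-hand side `q`. -/
theorem PosDef.dotProduct_inv_mulVec_le {V : Matrix n n ℝ} (hV : V.PosDef) {c : ℝ} (hc : 0 < c)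
    (h : ∀ u : n → ℝ, c * (u ⬝ᵥ u) ≤ u ⬝ᵥ V *ᵥ u) (x : n → ℝ) :
    x ⬝ᵥ V⁻¹ *ᵥ x ≤ (x ⬝ᵥ x) / c := by
  rw [le_div_iff₀ hc]
  have h1 := h (V⁻¹ *ᵥ x)
  rw [hV.mulVec_inv_mulVec, dotProduct_comm _ x] at h1
  have h2 := sq_dotProduct_le_dotProduct_self_mul x (V⁻¹ *ᵥ x)
  have hq : 0 ≤ x ⬝ᵥ V⁻¹ *ᵥ x := hV.inv.posSemidef.dotProduct_mulVec_self_nonneg x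
  have hx : 0 ≤ x ⬝ᵥ x := by
    simpa using (PosSemidef.one (n := n) (R := ℝ)).dotProduct_mulVec_self_nonneg x
  rcases hq.eq_or_lt with h0 | h0
  · rw [← h0]; simpa using hx
  · refine le_of_mul_le_mul_right ?_ h0
    nlinarith

/-- Each eigenvalue is the value of the form at a unit eigenvector, hence at most `c`. -/
theorem PosSemidef.det_le_pow {V : Matrix n n ℝ} (hV : V.PosSemidef) {c : ℝ}
    (h : ∀ u : n → ℝ, u ⬝ᵥ V *ᵥ u ≤ c * (u ⬝ᵥ u)) : V.det ≤ c ^ Fintype.card n := by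
  have hH := hV.isHermitian
  rw [hH.det_eq_prod_eigenvalues, ← Finset.card_univ, ← Finset.prod_const]
  refine Finset.prod_le_prod (fun i _ => by simpa using hV.eigenvalues_nonneg i) fun i _ => ?_
  have h1 := hH.eigenvalues_eq i
  have h2 := h (hH.eigenvectorBasis i).ofLp
  have h3 : (hH.eigenvectorBasis i).ofLp ⬝ᵥ (hH.eigenvectorBasis i).ofLp = 1 := by
    have := hH.eigenvectorBasis.orthonormal.1 i
    rw [EuclideanSpace.norm_eq, Real.sqrt_eq_one] at this
    simpa [dotProduct, ← sq] using this
  simp only [star_trivial, RCLike.re_to_real] at h1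
  rw [h3, mul_one, ← h1] at h2
  simpa using h2

end Matrix

open Matrix

/-! ### The Gram matrix: elliptical potential, confidence radius and confidence ellipsoids. -/

section gram

variable {d : ℕ} {reg : ℝ} (x : ℕ → Vec d)

theorem Vec.inner_eq_dotProduct (u v : Vec d) : inner ℝ u v = u.ofLp ⬝ᵥ v.ofLp := by
  rw [EuclideanSpace.inner_eq_star_dotProduct, star_trivial, dotProduct_comm]

theorem Vec.dotProduct_self (u : Vec d) : u.ofLp ⬝ᵥ u.ofLp = ‖u‖ ^ 2 := by
  rw [← Vec.inner_eq_dotProduct, real_inner_self_eq_norm_sq]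

theorem gramMatrix_zero : gramMatrix reg x 0 = reg • (1 : Matrix (Fin d) (Fin d) ℝ) := by
  simp [gramMatrix]

theorem gramMatrix_succ (t : ℕ) : gramMatrix reg x (t + 1) =
    gramMatrix reg x t + vecMulVec (x t).ofLp (x t).ofLp := by
  rw [gramMatrix, gramMatrix, Finset.sum_range_succ, add_assoc]

theorem gramMatrix_mulVec (t : ℕ) (u : Fin d → ℝ) : gramMatrix reg x t *ᵥ u =
    reg • u + ∑ τ ∈ Finset.range t, ((x τ).ofLp ⬝ᵥ u) • (x τ).ofLp := by
  rw [gramMatrix, add_mulVec, smul_mulVec, one_mulVec, sum_mulVec]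
  congr 1
  refine Finset.sum_congr rfl fun τ _ => ?_
  rw [vecMulVec_mulVec]
  ext i
  simp [mul_comm]

theorem dotProduct_gramMatrix_mulVec (t : ℕ) (u : Fin d → ℝ) : u ⬝ᵥ gramMatrix reg x t *ᵥ u =
    reg * (u ⬝ᵥ u) + ∑ τ ∈ Finset.range t, ((x τ).ofLp ⬝ᵥ u) ^ 2 := by
  rw [gramMatrix_mulVec, dotProduct_add, dotProduct_smul, dotProduct_sum, smul_eq_mul]
  congr 1
  refine Finset.sum_congr rfl fun τ _ => ?_
  rw [dotProduct_smul, smul_eq_mul, dotProduct_comm u, sq]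

theorem le_dotProduct_gramMatrix_mulVec (t : ℕ) (u : Fin d → ℝ) :
    reg * (u ⬝ᵥ u) ≤ u ⬝ᵥ gramMatrix reg x t *ᵥ u := by
  rw [dotProduct_gramMatrix_mulVec]
  linarith [Finset.sum_nonneg fun τ (_ : τ ∈ Finset.range t) => sq_nonneg ((x τ).ofLp ⬝ᵥ u)]

theorem posDef_gramMatrix (hreg : 0 < reg) (t : ℕ) : (gramMatrix reg x t).PosDef := by
  induction t with
  | zero => rw [gramMatrix_zero]; exact PosDef.one.smul hreg
  | succ t ih => rw [gramMatrix_succ]; exact ih.add_vecMulVec_self _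

/-- The squared width `‖x_t‖²` in the norm of `V⁻¹`. -/
noncomputable def sqWidth (reg : ℝ) (x : ℕ → Vec d) (t : ℕ) : ℝ :=
  (x t).ofLp ⬝ᵥ (gramMatrix reg x t)⁻¹ *ᵥ (x t).ofLp

theorem sqWidth_nonneg (hreg : 0 < reg) (t : ℕ) : 0 ≤ sqWidth reg x t :=
  (posDef_gramMatrix x hreg t).inv.posSemidef.dotProduct_mulVec_self_nonneg _

theorem det_gramMatrix_succ (hreg : 0 < reg) (t : ℕ) :
    (gramMatrix reg x (t + 1)).det = (gramMatrix reg x t).det * (1 + sqWidth reg x t) := by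
  rw [gramMatrix_succ, det_add_vecMulVec_self (posDef_gramMatrix x hreg t), sqWidth]

theorem sqWidth_le (hreg : 0 < reg) (t : ℕ) (hx : ‖x t‖ ≤ 1) : sqWidth reg x t ≤ 1 / reg := by
  refine ((posDef_gramMatrix x hreg t).dotProduct_inv_mulVec_le hreg
    (le_dotProduct_gramMatrix_mulVec x t) _).trans ?_
  rw [Vec.dotProduct_self]
  gcongr
  exact pow_le_one₀ (norm_nonneg _) hx

/-- The logarithm of `det V_t / det (reg I)`. -/
noncomputable def logDetRatio (reg : ℝ) (x : ℕ → Vec d) (t : ℕ) : ℝ :=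
  Real.log ((gramMatrix reg x t).det / reg ^ d)

theorem logDetRatio_le (hreg : 0 < reg) (t : ℕ) (hx : ∀ τ, ‖x τ‖ ≤ 1) :
    logDetRatio reg x t ≤ d * Real.log (1 + t / reg) := by
  have hV := posDef_gramMatrix x hreg t
  rw [logDetRatio, ← Real.log_pow]
  refine Real.log_le_log (div_pos hV.det_pos (by positivity)) ?_
  rw [div_le_iff₀ (by positivity), ← mul_pow]
  have h1 : (1 + t / reg) * reg = reg + t := by field_simp
  rw [h1]
  refine (hV.posSemidef.det_le_pow (c := reg + t) fun u => ?_).trans_eq (by simp)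
  rw [dotProduct_gramMatrix_mulVec, add_mul]
  have hu : 0 ≤ u ⬝ᵥ u := by
    simpa using (PosSemidef.one (n := Fin d) (R := ℝ)).dotProduct_mulVec_self_nonneg u
  have h2 : ∑ τ ∈ Finset.range t, ((x τ).ofLp ⬝ᵥ u) ^ 2 ≤ ∑ τ ∈ Finset.range t, u ⬝ᵥ u := by
    refine Finset.sum_le_sum fun τ _ => (sq_dotProduct_le_dotProduct_self_mul _ _).trans ?_
    rw [Vec.dotProduct_self]
    exact mul_le_of_le_one_left hu (pow_le_one₀ (norm_nonneg _) (hx τ))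
  simp only [Finset.sum_const, Finset.card_range, nsmul_eq_mul] at h2
  linarith

theorem logDetRatio_succ (hreg : 0 < reg) (t : ℕ) :
    logDetRatio reg x (t + 1) = logDetRatio reg x t + Real.log (1 + sqWidth reg x t) := by
  have hV := posDef_gramMatrix x hreg t
  rw [logDetRatio, logDetRatio, det_gramMatrix_succ x hreg, mul_div_right_comm,
    Real.log_mul (div_pos hV.det_pos (by positivity)).ne'
      (by linarith [sqWidth_nonneg x hreg t])]

/-- The elliptical potential lemma. -/
theorem sum_sqWidth_le (hreg : 0 < reg) (T : ℕ) (hx : ∀ τ, ‖x τ‖ ≤ 1) :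
    ∑ t ∈ Finset.range T, sqWidth reg x t ≤ (1 + 1 / reg) * logDetRatio reg x T := by
  induction T with
  | zero =>
    have : reg ^ d ≠ 0 := by positivity
    simp [logDetRatio, gramMatrix_zero, div_self this]
  | succ T ih =>
    rw [Finset.sum_range_succ, logDetRatio_succ x hreg, mul_add]
    refine add_le_add ih ?_
    have h0 := sqWidth_nonneg x hreg T
    have h1 := sqWidth_le x hreg T (hx T)
    -- With `q` the squared width, `q = (1 + q)(1 - 1/(1 + q))`; the first factor is at most `1 +
    -- 1/reg` and the second at most `log (1 + q)`.
    have h2 := Real.one_sub_inv_le_log_of_pos (show 0 < 1 + sqWidth reg x T by linarith)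
    have h3 : sqWidth reg x T = (1 + sqWidth reg x T) * (1 - (1 + sqWidth reg x T)⁻¹) := by
      field_simp
      ring
    have h4 : 0 ≤ 1 - (1 + sqWidth reg x T)⁻¹ := by
      rw [sub_nonneg]
      exact inv_le_one_of_one_le₀ (by linarith)
    rw [h3]
    refine mul_le_mul ?_ (by rwa [← h3]) h4 (by positivity)
    linarith

theorem logDetRatio_mono (hreg : 0 < reg) : Monotone (logDetRatio reg x) :=
  monotone_nat_of_le_succ fun t => by
    rw [logDetRatio_succ x hreg]
    linarith [Real.log_nonneg (show 1 ≤ 1 + sqWidth reg x t by linarith [sqWidth_nonneg x hreg t])]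

theorem logDetRatio_nonneg (hreg : 0 < reg) (t : ℕ) : 0 ≤ logDetRatio reg x t := by
  refine le_trans ?_ (logDetRatio_mono x hreg t.zero_le)
  have : reg ^ d ≠ 0 := by positivity
  simp [logDetRatio, gramMatrix_zero, div_self this]

theorem confRadius_eq (hreg : 0 < reg) {δ : ℝ} (hδ : 0 < δ) (U t : ℕ) :
    confRadius U reg δ x t =
      √(2 * Real.log (((U : ℝ) + 1) / δ) + logDetRatio reg x t) + √reg := by
  have hV := (posDef_gramMatrix x hreg t).det_pos
  have hr : 0 < reg ^ d := by positivity
  rw [confRadius, det_smul, det_one, mul_one, Fintype.card_fin]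
  have h1 : ((U : ℝ) + 1) * √((gramMatrix reg x t).det) * (√(reg ^ d))⁻¹ / δ =
      (((U : ℝ) + 1) / δ) * √((gramMatrix reg x t).det / reg ^ d) := by
    rw [Real.sqrt_div hV.le]
    field_simp
  rw [h1, Real.log_mul (by positivity) (Real.sqrt_pos.mpr (div_pos hV hr)).ne',
    Real.log_sqrt (div_pos hV hr).le, logDetRatio]
  congr 2
  ring

theorem confRadius_pos (hreg : 0 < reg) (U : ℕ) (δ : ℝ) (t : ℕ) : 0 < confRadius U reg δ x t :=
  add_pos_of_nonneg_of_pos (Real.sqrt_nonneg _) (Real.sqrt_pos.mpr hreg)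

theorem abs_inner_sub_le_of_matNorm_le (hreg : 0 < reg) {t : ℕ} {b : ℝ} {u : Vec d}
    (h : matNorm (gramMatrix reg x t) u ≤ b) : |inner ℝ u (x t)| ≤ b * √(sqWidth reg x t) := by
  have hV := posDef_gramMatrix x hreg t
  refine le_trans ?_ (mul_le_mul_of_nonneg_right h (Real.sqrt_nonneg _))
  rw [matNorm, ← Real.sqrt_mul (hV.posSemidef.dotProduct_mulVec_self_nonneg _),
    Vec.inner_eq_dotProduct]
  exact Real.abs_le_sqrt (hV.sq_dotProduct_le _ _)

/-- Two points of a confidence ellipsoid differ by at most twice its width at `x_t`. -/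
theorem abs_inner_sub_inner_le (hreg : 0 < reg) {U t : ℕ} {δ : ℝ} {y : ℕ → ℝ} {u v : Vec d}
    (hu : u ∈ confEllipsoid U reg δ x y t) (hv : v ∈ confEllipsoid U reg δ x y t) :
    |inner ℝ u (x t) - inner ℝ v (x t)| ≤
      2 * (confRadius U reg δ x t * √(sqWidth reg x t)) := by
  have h1 := abs_le.mp (abs_inner_sub_le_of_matNorm_le x hreg hu)
  have h2 := abs_le.mp (abs_inner_sub_le_of_matNorm_le x hreg hv)
  rw [inner_sub_left] at h1 h2
  rw [abs_le]
  constructor <;> linarith [h1.1, h1.2, h2.1, h2.2]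

/-- The noise part `∑ η_τ x_τ` of the regression. -/
noncomputable def noiseSum (x : ℕ → Vec d) (η : ℕ → ℝ) (t : ℕ) : Fin d → ℝ :=
  ∑ τ ∈ Finset.range t, η τ • (x τ).ofLp

theorem noiseSum_succ (η : ℕ → ℝ) (t : ℕ) :
    noiseSum x η (t + 1) = noiseSum x η t + η t • (x t).ofLp :=
  Finset.sum_range_succ _ _

/-- The true parameter lies in the confidence ellipsoid when the noise is small in the norm of
`V⁻¹`. -/
theorem mem_confEllipsoid_of_noiseSum (hreg : 0 < reg) {U t : ℕ} {δ : ℝ} (hδ : 0 < δ)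
    {y η : ℕ → ℝ} {v : Vec d} (hv : ‖v‖ ≤ 1) (hy : ∀ τ, y τ = inner ℝ v (x τ) + η τ)
    (h : noiseSum x η t ⬝ᵥ (gramMatrix reg x t)⁻¹ *ᵥ noiseSum x η t ≤
      2 * Real.log (((U : ℝ) + 1) / δ) + logDetRatio reg x t) :
    v ∈ confEllipsoid U reg δ x y t := by
  have hV := posDef_gramMatrix x hreg t
  -- The responses sum to `V v - reg v + S`, so the estimation error is `V⁻¹(reg v) - V⁻¹ S`. The
  -- bias has `V`-norm at most `√reg` and the noise term is controlled by `h`: these are the two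
  -- summands of the radius.
  have hsum : ∑ τ ∈ Finset.range t, y τ • (x τ).ofLp =
      gramMatrix reg x t *ᵥ v.ofLp + (-reg) • v.ofLp + noiseSum x η t := by
    rw [gramMatrix_mulVec, noiseSum, add_comm (reg • v.ofLp), add_assoc (∑ _ ∈ _, _), ← add_smul,
      add_neg_cancel, zero_smul, add_zero, ← Finset.sum_add_distrib]
    refine Finset.sum_congr rfl fun τ _ => ?_
    rw [hy, add_smul, Vec.inner_eq_dotProduct, dotProduct_comm]
  have hdiff : (v - rlsEstimate reg x y t).ofLp =
      (gramMatrix reg x t)⁻¹ *ᵥ (reg • v.ofLp) + (gramMatrix reg x t)⁻¹ *ᵥ (-noiseSum x η t) := by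
    rw [WithLp.ofLp_sub, rlsEstimate, hsum, mulVec_add, mulVec_add, hV.inv_mulVec_mulVec,
      neg_smul, mulVec_neg, mulVec_neg]
    ext i
    simp only [Pi.sub_apply, Pi.add_apply, Pi.neg_apply]
    ring
  have hinv : ∀ u : Fin d → ℝ, ((gramMatrix reg x t)⁻¹ *ᵥ u) ⬝ᵥ
      gramMatrix reg x t *ᵥ ((gramMatrix reg x t)⁻¹ *ᵥ u) = u ⬝ᵥ (gramMatrix reg x t)⁻¹ *ᵥ u :=
    fun u => by rw [hV.mulVec_inv_mulVec, dotProduct_comm]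
  change matNorm _ _ ≤ confRadius U reg δ x t
  rw [confRadius_eq x hreg hδ, matNorm, hdiff]
  refine (hV.posSemidef.sqrt_dotProduct_mulVec_add_le _ _).trans ?_
  rw [add_comm]
  refine add_le_add ?_ ?_
  · rw [hinv]
    refine Real.sqrt_le_sqrt ?_
    simpa [mulVec_neg] using h
  · rw [hinv]
    refine Real.sqrt_le_sqrt ?_
    have h1 := hV.dotProduct_inv_mulVec_le hreg (le_dotProduct_gramMatrix_mulVec x t) (reg • v.ofLp)
    refine h1.trans ?_
    rw [smul_dotProduct, dotProduct_smul, Vec.dotProduct_self, smul_eq_mul, smul_eq_mul,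
      mul_div_cancel_left₀ _ hreg.ne']
    exact mul_le_of_le_one_right hreg.le (pow_le_one₀ (norm_nonneg _) hv)

end gram

/-! ### Maximisers over ellipsoids, and what the algorithm's choice implies. -/

open Matrix in
/-- A maximiser of a nonzero linear functional over an ellipsoid is where the normal of the ellipsoid
points in the direction of the functional. -/
theorem exists_pos_smul_of_isMax_ellipsoid {d : ℕ} {V : Matrix (Fin d) (Fin d) ℝ} (hV : V.PosDef)
    {b : ℝ} (hb : 0 < b) {c φ z : Vec d} (hz : z ≠ 0) (hφ : matNorm V (φ - c) ≤ b)
    (hmax : ∀ ψ : Vec d, matNorm V (ψ - c) ≤ b → inner ℝ ψ z ≤ inner ℝ φ z) :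
    ∃ k : ℝ, 0 < k ∧ V *ᵥ (φ - c).ofLp = k • z.ofLp := by
  have hz' : z.ofLp ≠ 0 := fun h => hz (by ext i; simp [h])
  have hq : 0 < z.ofLp ⬝ᵥ V⁻¹ *ᵥ z.ofLp := by
    simpa using hV.inv.dotProduct_mulVec_pos hz'
  set q := z.ofLp ⬝ᵥ V⁻¹ *ᵥ z.ofLp with hqdef
  set N := √q with hN
  have hN0 : 0 < N := Real.sqrt_pos.mpr hq
  have hNq : N * N = q := Real.mul_self_sqrt hq.le
  set e := (φ - c).ofLp with he
  set w : Fin d → ℝ := (b / N) • V⁻¹ *ᵥ z.ofLp with hw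
  have hVw : V *ᵥ w = (b / N) • z.ofLp := by rw [hw, mulVec_smul, hV.mulVec_inv_mulVec]
  have hwz : w ⬝ᵥ z.ofLp = b * N := by
    rw [hw, smul_dotProduct, dotProduct_comm, ← hqdef, ← hNq, smul_eq_mul]
    field_simp
  have hww : w ⬝ᵥ V *ᵥ w = b ^ 2 := by
    rw [hVw, dotProduct_smul, hwz, smul_eq_mul]
    field_simp
  have hmaxw := hmax (c + WithLp.toLp 2 w) (by
    have : (c + WithLp.toLp 2 w - c).ofLp = w := by simp
    rw [matNorm, this, hww, Real.sqrt_sq hb.le])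
  have hez : b * N ≤ e ⬝ᵥ z.ofLp := by
    rw [inner_add_left, Vec.inner_eq_dotProduct (WithLp.toLp 2 w)] at hmaxw
    change _ + w ⬝ᵥ z.ofLp ≤ _ at hmaxw
    have : inner ℝ (φ - c) z = e ⬝ᵥ z.ofLp := Vec.inner_eq_dotProduct _ _
    rw [inner_sub_left] at this
    linarith
  have hee : e ⬝ᵥ V *ᵥ e ≤ b ^ 2 := (Real.sqrt_le_left hb.le).mp hφ
  -- `w` is the explicit maximiser relative to the centre. Both `e` and `w` have `V`-norm at most
  -- `b`, while `⟨e, V w⟩ ≥ b²` by optimality; equality in Cauchy–Schwarz forces `e = w`.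
  have hzero : e - w = 0 := by
    by_contra hne
    have hpos : 0 < (e - w) ⬝ᵥ V *ᵥ (e - w) := by
      simpa using hV.dotProduct_mulVec_pos hne
    rw [mulVec_sub, dotProduct_sub, sub_dotProduct, sub_dotProduct, hww,
      hV.isHermitian.dotProduct_mulVec_comm w e, hVw, dotProduct_smul, smul_eq_mul] at hpos
    have : b ^ 2 ≤ b / N * (e ⬝ᵥ z.ofLp) := by
      calc b ^ 2 = b / N * (b * N) := by field_simp
        _ ≤ _ := by gcongr
    linarith
  exact ⟨b / N, by positivity, by rw [sub_eq_zero.mp hzero, hVw]⟩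

theorem exists_ne_zero_orthogonal {ι : Type*} {d : ℕ} (A : Finset ι) (v : ι → Vec d)
    (hA : A.card < d) : ∃ u : Vec d, u ≠ 0 ∧ ∀ i ∈ A, inner ℝ (v i) u = 0 := by
  let f : Vec d →ₗ[ℝ] (A → ℝ) := LinearMap.pi fun i => (innerSL ℝ (v i)).toLinearMap
  have hf : LinearMap.ker f ≠ ⊥ := LinearMap.ker_ne_bot_of_finrank_lt (by simpa using hA)
  obtain ⟨u, hu, hu0⟩ := Submodule.exists_mem_ne_zero_of_ne_bot hf
  exact ⟨u, hu0, fun i hi => congrFun (LinearMap.mem_ker.mp hu) ⟨i, hi⟩⟩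

namespace SafeBandit

variable {d K U : ℕ}

/-- The action chosen by the algorithm is noisily associated with a basic index set. -/
theorem IsDOSLBRound.exists_noisyAssoc {B : SafeBandit d K U} {reg δ : ℝ} (hreg : 0 < reg)
    {x θt : ℕ → Vec d} {r : ℕ → ℝ} {s : ℕ → ConIdx K U → ℝ} {t : ℕ}
    (h : B.IsDOSLBRound reg δ x θt r s t) (hne : (B.permissible reg δ x s t).Nonempty)
    (h0 : inner ℝ (θt t) (x t) ≠ 0) :
    ∃ I, B.IsBIS I ∧ B.NoisyAssoc reg δ x s t I (x t) := by
  classical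
  obtain ⟨hxK, h⟩ := h
  obtain ⟨hxP, hθ, hmax⟩ := h hne
  let A : Finset (ConIdx K U) :=
    Finset.univ.filter fun i => ∃ v ∈ B.conf reg δ x s t i, inner ℝ v (x t) = B.α i
  by_cases hA : d ≤ A.card
  · obtain ⟨I, hIA, hI⟩ := Finset.exists_subset_card_eq hA
    exact ⟨I, hI, hxK, fun i hi => (Finset.mem_filter.mp (hIA hi)).2⟩
  exfalso
  have hv : ∀ i, ∃ v ∈ B.conf reg δ x s t i, (i ∈ A → inner ℝ v (x t) = B.α i) ∧
      (i ∉ A → inner ℝ v (x t) < B.α i) := by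
    intro i
    by_cases hi : i ∈ A
    · obtain ⟨v, hv, hvx⟩ := (Finset.mem_filter.mp hi).2
      exact ⟨v, hv, fun _ => hvx, fun h => absurd hi h⟩
    · obtain ⟨v, hv, hvx⟩ := hxP.2 i
      exact ⟨v, hv, fun h => absurd h hi, fun _ => lt_of_le_of_ne hvx fun heq =>
        hi (Finset.mem_filter.mpr ⟨Finset.mem_univ _, v, hv, heq⟩)⟩
  choose v hvC hvA hvN using hv
  -- Moving along `u` keeps the fewer than `d` tight constraints tight, and a small step keeps the
  -- others strict; both `x_t ± ε u` are therefore permissible.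
  obtain ⟨u, hu0, hu⟩ := exists_ne_zero_orthogonal A v (not_le.mp hA)
  obtain ⟨ε, hε, hεv⟩ : ∃ ε > 0, ∀ i, i ∉ A →
      inner ℝ (v i) (x t) + ε * |inner ℝ (v i) u| < B.α i := by
    have : ∀ i, ∀ᶠ ε in nhdsWithin (0 : ℝ) (Set.Ioi 0), i ∉ A →
        inner ℝ (v i) (x t) + ε * |inner ℝ (v i) u| < B.α i := by
      intro i
      by_cases hi : i ∈ A
      · exact Filter.Eventually.of_forall fun _ h => absurd hi h
      · have ht : Filter.Tendsto (fun ε : ℝ => inner ℝ (v i) (x t) + ε * |inner ℝ (v i) u|)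
            (nhds 0) (nhds (inner ℝ (v i) (x t) + 0 * |inner ℝ (v i) u|)) :=
          Continuous.tendsto (by fun_prop) 0
        rw [zero_mul, add_zero] at ht
        exact ((ht.mono_left nhdsWithin_le_nhds).eventually (gt_mem_nhds (hvN i hi))).mono
          fun _ h _ => h
    obtain ⟨ε, h3, h4⟩ := ((Filter.eventually_all.2 this).and self_mem_nhdsWithin).exists
    exact ⟨ε, h4, h3⟩
  have hperm : ∀ c : ℝ, |c| = ε → x t + c • u ∈ B.permissible reg δ x s t := by
    intro c hc
    have hle : ∀ i, inner ℝ (v i) (x t + c • u) ≤ B.α i := by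
      intro i
      rw [inner_add_right, real_inner_smul_right]
      by_cases hi : i ∈ A
      · rw [hu i hi, mul_zero, add_zero, hvA i hi]
      · refine le_trans ?_ (hεv i hi).le
        rw [← hc, ← abs_mul]
        linarith [le_abs_self (c * inner ℝ (v i) u)]
    refine ⟨fun i => ?_, fun i => ⟨v i, hvC i, hle i⟩⟩
    have h1 : v (Sum.inl i) = B.a (Sum.inl i) := hvC (Sum.inl i)
    rw [← h1]
    exact hle _
  have hp := hmax _ (hperm ε (abs_of_pos hε))
  have hm := hmax _ (hperm (-ε) (by rw [abs_neg, abs_of_pos hε]))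
  -- The optimal value can increase in neither direction, so `θt t` is constant along the line and
  -- is also a maximiser over the ellipsoid at `x_t + ε u`.
  have hθu : inner ℝ (θt t) u = 0 := by
    have h1 := hp _ hθ
    have h2 := hm _ hθ
    rw [inner_add_right, real_inner_smul_right] at h1 h2
    nlinarith
  have hθz : inner ℝ (θt t) (x t + ε • u) = inner ℝ (θt t) (x t) := by
    rw [inner_add_right, real_inner_smul_right, hθu, mul_zero, add_zero]
  have hx0 : x t ≠ 0 := fun h => h0 (by rw [h, inner_zero_right])
  have hz0 : x t + ε • u ≠ 0 := fun h => h0 (by rw [← hθz, h, inner_zero_right])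
  have hV := posDef_gramMatrix x hreg t
  have hb := confRadius_pos x hreg U δ t
  obtain ⟨k, hk, hk'⟩ := exists_pos_smul_of_isMax_ellipsoid hV hb hx0 hθ
    fun ψ hψ => hmax _ hxP ψ hψ
  obtain ⟨l, hl, hl'⟩ := exists_pos_smul_of_isMax_ellipsoid hV hb hz0 hθ
    fun ψ hψ => (hp ψ hψ).trans_eq hθz.symm
  have heq : k • x t = l • (x t + ε • u) := by
    apply (WithLp.ofLp_injective 2)
    exact hk'.symm.trans hl'
  -- The same ellipsoid normal is a positive multiple of both points. Pairing with `θt t`, nonzero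
  -- at `x_t`, equates the factors and gives `ε u = 0`.
  have hkl : k = l := by
    have := congrArg (fun z => inner ℝ (θt t) z) heq
    simp only [real_inner_smul_right, hθz] at this
    exact mul_right_cancel₀ h0 this
  rw [hkl] at heq
  have := smul_right_injective _ hl.ne' heq
  simp [hε.ne', hu0] at this

/-- If the confidence sets contain the true parameters, an action that is noisily associated with
`I` nearly is basic for `I`. -/
theorem IsDOSLBRound.nearlyBasic {B : SafeBandit d K U} {reg δ : ℝ} (hreg : 0 < reg)
    {x θt : ℕ → Vec d} {r : ℕ → ℝ} {s : ℕ → ConIdx K U → ℝ} {t : ℕ} {xs : Vec d}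
    (h : B.IsDOSLBRound reg δ x θt r s t) (hxs : xs ∈ B.feasible)
    (hθ : B.θ ∈ confEllipsoid U reg δ x r t) (ha : ∀ i, B.a i ∈ B.conf reg δ x s t i)
    {I : Finset (ConIdx K U)} (hI : B.NoisyAssoc reg δ x s t I (x t)) :
    B.NearlyBasic xs (2 * (confRadius U reg δ x t * √(sqWidth reg x t))) I (x t) := by
  have hxsP : xs ∈ B.permissible reg δ x s t := by
    refine ⟨hxs.1, fun i => ⟨B.a i, ha i, ?_⟩⟩
    rcases i with i | i
    · exact hxs.1 i
    · exact hxs.2 i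
  obtain ⟨hxK, h⟩ := h
  obtain ⟨hxP, hθt, hmax⟩ := h ⟨xs, hxsP⟩
  have hw : 0 ≤ 2 * (confRadius U reg δ x t * √(sqWidth reg x t)) := by
    have := confRadius_pos x hreg U δ t
    positivity
  have hclose : ∀ i, ∀ v ∈ B.conf reg δ x s t i, |inner ℝ (B.a i) (x t) - inner ℝ v (x t)| ≤
      2 * (confRadius U reg δ x t * √(sqWidth reg x t)) := by
    rintro (i | i) v hv
    · rw [show v = B.a (Sum.inl i) from hv, sub_self, abs_zero]
      exact hw
    · exact abs_inner_sub_inner_le x hreg (ha (Sum.inr i)) hv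
  refine ⟨hw, hxK, fun i hi => ?_, fun i hi => ?_, fun i => ?_, ?_⟩
  · obtain ⟨v, hv, hvx⟩ := hI.2 i hi
    rw [← hvx]
    exact hclose i v hv
  · obtain ⟨hi, hk⟩ := Finset.mem_inter.mp hi
    obtain ⟨v, hv, hvx⟩ := hI.2 i hi
    rcases i with i | i
    · rwa [← show v = B.a (Sum.inl i) from hv]
    · simp [mem_knownIdx] at hk
  · obtain ⟨v, hv, hvx⟩ := hxP.2 i
    linarith [(abs_le.mp (hclose i v hv)).2]
  -- Optimism: `(xs, θ)` competes in the maximisation, so `⟨θ, xs⟩ ≤ ⟨θt, x_t⟩ ≤ ⟨θ, x_t⟩ + w`.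
  · have h1 := hmax xs hxsP B.θ hθ
    have h2 := (abs_le.mp (abs_inner_sub_inner_le x hreg hθ hθt)).1
    linarith

end SafeBandit

/-! ### Measurability of the regression quantities. -/

section measurability

variable {Ω : Type*} {m : MeasurableSpace Ω} {n : Type*} [Fintype n] [DecidableEq n]

open Matrix

theorem Matrix.measurable_det {V : Ω → Matrix n n ℝ} (hV : ∀ i j, Measurable fun ω => V ω i j) :
    Measurable fun ω => (V ω).det := by
  simp only [det_apply']
  exact Finset.measurable_sum _ fun σ _ =>
    (Finset.measurable_prod _ fun i _ => hV _ _).const_mul _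

theorem Matrix.measurable_inv_apply {V : Ω → Matrix n n ℝ}
    (hV : ∀ i j, Measurable fun ω => V ω i j) (i j : n) :
    Measurable fun ω => (V ω)⁻¹ i j := by
  simp only [inv_def, Ring.inverse_eq_inv', smul_apply, smul_eq_mul, adjugate_apply]
  refine (measurable_det hV).inv.mul (measurable_det fun k l => ?_)
  by_cases hk : k = j
  · subst hk
    simp
  · simpa [updateRow_ne hk] using hV k l

theorem Matrix.measurable_dotProduct_inv_mulVec {V : Ω → Matrix n n ℝ} {u w : Ω → n → ℝ}
    (hV : ∀ i j, Measurable fun ω => V ω i j) (hu : ∀ i, Measurable fun ω => u ω i)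
    (hw : ∀ i, Measurable fun ω => w ω i) :
    Measurable fun ω => u ω ⬝ᵥ (V ω)⁻¹ *ᵥ w ω := by
  simp only [dotProduct, mulVec]
  exact Finset.measurable_sum _ fun i _ => (hu i).mul
    (Finset.measurable_sum _ fun j _ => (measurable_inv_apply hV i j).mul (hw j))

variable {d : ℕ} {x : ℕ → Ω → Vec d} {η : ℕ → Ω → ℝ} {t : ℕ}

theorem Vec.measurable_apply {u : Ω → Vec d} (hu : Measurable u) (i : Fin d) :
    Measurable fun ω => u ω i :=
  (EuclideanSpace.proj (𝕜 := ℝ) i).continuous.measurable.comp hu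

theorem measurable_gramMatrix_apply (reg : ℝ) (hx : ∀ τ < t, Measurable (x τ)) (i j : Fin d) :
    Measurable fun ω => gramMatrix reg (fun τ => x τ ω) t i j := by
  simp only [gramMatrix, Matrix.add_apply, Matrix.sum_apply, vecMulVec_apply]
  exact measurable_const.add (Finset.measurable_sum _ fun τ hτ =>
    (Vec.measurable_apply (hx τ (Finset.mem_range.mp hτ)) i).mul
      (Vec.measurable_apply (hx τ (Finset.mem_range.mp hτ)) j))

theorem measurable_noiseSum_apply (hx : ∀ τ < t, Measurable (x τ))
    (hη : ∀ τ < t, Measurable (η τ)) (i : Fin d) :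
    Measurable fun ω => noiseSum (fun τ => x τ ω) (fun τ => η τ ω) t i := by
  simp only [noiseSum, Finset.sum_apply, Pi.smul_apply, smul_eq_mul]
  exact Finset.measurable_sum _ fun τ hτ => (hη τ (Finset.mem_range.mp hτ)).mul
    (Vec.measurable_apply (hx τ (Finset.mem_range.mp hτ)) i)

theorem measurable_logDetRatio (reg : ℝ) (hx : ∀ τ < t, Measurable (x τ)) :
    Measurable fun ω => logDetRatio reg (fun τ => x τ ω) t :=
  Real.measurable_log.comp
    ((Matrix.measurable_det (measurable_gramMatrix_apply reg hx)).div_const _)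

end measurability

/-! ### The method of mixtures for one step, and Ville's inequality. -/

section mixture

variable {Ω : Type*} {m m0 : MeasurableSpace Ω} {μ : Measure Ω} [IsProbabilityMeasure μ]

/-- On `m`-measurable sets the measure with density `exp (ξ η)` is dominated by `exp (ξ²/2) • μ`.
Comparing the two measures on `m` handles every `m`-measurable `H ≥ 0` without integrability. -/
theorem CondSubGaussian.lintegral_mul_exp_le (hm : m ≤ m0) {η : Ω → ℝ}
    (h : CondSubGaussian μ m η) (hη : Measurable η) (ξ : ℝ) {H : Ω → ENNReal}
    (hH : Measurable[m] H) :
    ∫⁻ ω, H ω * ENNReal.ofReal (Real.exp (ξ * η ω)) ∂μ ≤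
      ∫⁻ ω, H ω * ENNReal.ofReal (Real.exp (ξ ^ 2 / 2)) ∂μ := by
  obtain ⟨hint, hle⟩ := h.2.2 ξ
  have hf : Measurable fun ω => ENNReal.ofReal (Real.exp (ξ * η ω)) := by fun_prop
  have hH0 : Measurable H := hH.mono hm le_rfl
  set ν := μ.withDensity fun ω => ENNReal.ofReal (Real.exp (ξ * η ω)) with hν
  have htrim : ν.trim hm ≤ (ENNReal.ofReal (Real.exp (ξ ^ 2 / 2)) • μ).trim hm := by
    refine Measure.le_iff.mpr fun s hs => ?_
    rw [trim_measurableSet_eq hm hs, trim_measurableSet_eq hm hs, hν,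
      withDensity_apply _ (hm s hs), Measure.smul_apply, smul_eq_mul,
      ← ofReal_integral_eq_lintegral_ofReal hint.integrableOn
        (Filter.Eventually.of_forall fun ω => (Real.exp_pos _).le),
      ← setIntegral_condExp hm hint hs]
    have : ∫ ω in s, (μ[fun ω => Real.exp (ξ * η ω) | m]) ω ∂μ ≤
        ∫ ω in s, Real.exp (ξ ^ 2 / 2) ∂μ :=
      setIntegral_mono_ae integrable_condExp.integrableOn (integrable_const _).integrableOn hle
    refine (ENNReal.ofReal_le_ofReal this).trans_eq ?_
    rw [setIntegral_const, smul_eq_mul, ENNReal.ofReal_mul measureReal_nonneg, mul_comm,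
      ofReal_measureReal]
  calc ∫⁻ ω, H ω * ENNReal.ofReal (Real.exp (ξ * η ω)) ∂μ
      = ∫⁻ ω, H ω ∂ν := by
        rw [hν, lintegral_withDensity_eq_lintegral_mul _ hf hH0]
        exact lintegral_congr fun ω => mul_comm _ _
    _ = ∫⁻ ω, H ω ∂(ν.trim hm) := (lintegral_trim hm hH).symm
    _ ≤ ∫⁻ ω, H ω ∂((ENNReal.ofReal (Real.exp (ξ ^ 2 / 2)) • μ).trim hm) :=
        lintegral_mono' htrim le_rfl
    _ = _ := by
        rw [lintegral_trim hm hH, lintegral_smul_measure, smul_eq_mul,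
          lintegral_mul_const _ hH0, mul_comm]

theorem lintegral_gaussian_density_eq_one (c : ℝ) {v : ℝ} (hv : 0 < v) :
    ∫⁻ ξ : ℝ, ENNReal.ofReal ((√(2 * Real.pi * v))⁻¹ * Real.exp (-(ξ - c) ^ 2 / (2 * v))) = 1 := by
  have := ProbabilityTheory.lintegral_gaussianPDF_eq_one c (v := v.toNNReal)
    (Real.toNNReal_pos.mpr hv).ne'
  simpa only [ProbabilityTheory.gaussianPDF, ProbabilityTheory.gaussianPDFReal,
    Real.coe_toNNReal v hv.le] using this

/-- The mixing density of the one-step mixture. -/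
noncomputable def mixDensity (p q ξ : ℝ) : ℝ :=
  √(1 + q) * Real.exp (-ξ ^ 2 / 2) * ((√(2 * Real.pi * q))⁻¹ * Real.exp (-(ξ - p) ^ 2 / (2 * q)))

theorem mixDensity_zero (p ξ : ℝ) : mixDensity p 0 ξ = 0 := by
  simp [mixDensity]

@[fun_prop]
theorem measurable_mixDensity {α : Type*} [MeasurableSpace α] {p q ξ : α → ℝ} (hp : Measurable p)
    (hq : Measurable q) (hξ : Measurable ξ) :
    Measurable fun a => mixDensity (p a) (q a) (ξ a) := by
  unfold mixDensity
  fun_prop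

theorem mixDensity_nonneg (p q ξ : ℝ) : 0 ≤ mixDensity p q ξ := by
  unfold mixDensity; positivity

/-- The factor `exp (-ξ²/2)` of the mixing density cancels, leaving the total mass of the Gaussian
`N(p, q)`. -/
theorem lintegral_mixDensity_mul_exp_sq {p q : ℝ} (hq : 0 < q) :
    ∫⁻ ξ : ℝ, ENNReal.ofReal (mixDensity p q ξ) * ENNReal.ofReal (Real.exp (ξ ^ 2 / 2)) =
      ENNReal.ofReal √(1 + q) := by
  have h : ∀ ξ : ℝ, ENNReal.ofReal (mixDensity p q ξ) * ENNReal.ofReal (Real.exp (ξ ^ 2 / 2)) =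
      ENNReal.ofReal √(1 + q) *
        ENNReal.ofReal ((√(2 * Real.pi * q))⁻¹ * Real.exp (-(ξ - p) ^ 2 / (2 * q))) := by
    intro ξ
    rw [← ENNReal.ofReal_mul (mixDensity_nonneg p q ξ), ← ENNReal.ofReal_mul (Real.sqrt_nonneg _)]
    congr 1
    have : Real.exp (-ξ ^ 2 / 2) * Real.exp (ξ ^ 2 / 2) = 1 := by
      rw [← Real.exp_add, ← Real.exp_zero]; congr 1; ring
    rw [mixDensity]
    linear_combination (√(1 + q) *
      ((√(2 * Real.pi * q))⁻¹ * Real.exp (-(ξ - p) ^ 2 / (2 * q)))) * this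
  simp only [h]
  rw [lintegral_const_mul _ (by fun_prop), lintegral_gaussian_density_eq_one p hq, mul_one]

/-- Completing the square leaves a Gaussian of mean `(p + qη)/(1 + q)` and variance `q/(1 + q)`. -/
theorem lintegral_mixDensity_mul_exp {p q : ℝ} (hq : 0 < q) (η : ℝ) :
    ∫⁻ ξ : ℝ, ENNReal.ofReal (mixDensity p q ξ) * ENNReal.ofReal (Real.exp (ξ * η)) =
      ENNReal.ofReal (Real.exp ((2 * η * p + η ^ 2 * q - p ^ 2) / (2 * (1 + q)))) := by
  have hv : 0 < q / (1 + q) := by positivity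
  have h : ∀ ξ : ℝ, ENNReal.ofReal (mixDensity p q ξ) * ENNReal.ofReal (Real.exp (ξ * η)) =
      ENNReal.ofReal (Real.exp ((2 * η * p + η ^ 2 * q - p ^ 2) / (2 * (1 + q)))) *
        ENNReal.ofReal ((√(2 * Real.pi * (q / (1 + q))))⁻¹ *
          Real.exp (-(ξ - (p + q * η) / (1 + q)) ^ 2 / (2 * (q / (1 + q))))) := by
    intro ξ
    rw [← ENNReal.ofReal_mul (mixDensity_nonneg p q ξ), ← ENNReal.ofReal_mul (Real.exp_pos _).le]
    congr 1
    have h1 : √(2 * Real.pi * (q / (1 + q))) = √(2 * Real.pi * q) / √(1 + q) := by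
      rw [← mul_div_assoc, Real.sqrt_div (by positivity)]
    have h2 : Real.exp (-ξ ^ 2 / 2) * Real.exp (-(ξ - p) ^ 2 / (2 * q)) * Real.exp (ξ * η) =
        Real.exp ((2 * η * p + η ^ 2 * q - p ^ 2) / (2 * (1 + q))) *
          Real.exp (-(ξ - (p + q * η) / (1 + q)) ^ 2 / (2 * (q / (1 + q)))) := by
      rw [← Real.exp_add, ← Real.exp_add, ← Real.exp_add]
      congr 1
      have : (1 + q) ≠ 0 := by positivity
      field_simp
      ring
    rw [mixDensity, h1, inv_div]
    linear_combination (√(1 + q) / √(2 * Real.pi * q)) * h2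
  simp only [h]
  rw [lintegral_const_mul _ (by fun_prop), lintegral_gaussian_density_eq_one _ hv, mul_one]

/-- One step of the method of mixtures. -/
theorem CondSubGaussian.lintegral_mul_exp_quadratic_le (hm : m ≤ m0)
    {η : Ω → ℝ} (h : CondSubGaussian μ m η) (hη : Measurable η) {p q : Ω → ℝ}
    (hp : Measurable[m] p) (hq : Measurable[m] q) (hq0 : ∀ ω, 0 ≤ q ω)
    (hpq : ∀ ω, q ω = 0 → p ω = 0) {H : Ω → ENNReal} (hH : Measurable[m] H) :
    ∫⁻ ω, H ω * ENNReal.ofReal (Real.exp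
        ((2 * η ω * p ω + η ω ^ 2 * q ω - p ω ^ 2) / (2 * (1 + q ω)))) ∂μ ≤
      ∫⁻ ω, H ω * ENNReal.ofReal √(1 + q ω) ∂μ := by
  have hp0 : Measurable p := hp.mono hm le_rfl
  have hqm : Measurable q := hq.mono hm le_rfl
  have hH0 : Measurable H := hH.mono hm le_rfl
  -- Where `q = 0` the mixing density is identically `0` by convention; there also `p = 0`, and both
  -- integrands reduce to `H`, which `I` restores.
  set I : Ω → ENNReal := {ω | q ω = 0}.indicator 1 with hI
  have hImeas : Measurable I :=
    measurable_one.indicator (hqm (measurableSet_singleton 0))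
  have hL : ∀ ω, H ω * ENNReal.ofReal (Real.exp
        ((2 * η ω * p ω + η ω ^ 2 * q ω - p ω ^ 2) / (2 * (1 + q ω)))) =
      H ω * I ω + ∫⁻ ξ : ℝ, H ω * ENNReal.ofReal (mixDensity (p ω) (q ω) ξ) *
        ENNReal.ofReal (Real.exp (ξ * η ω)) := by
    intro ω
    rcases (hq0 ω).eq_or_lt with h0 | h0
    · simp [hI, mixDensity_zero, ← h0, hpq ω h0.symm]
    · simp only [mul_assoc]
      rw [lintegral_const_mul _ (by fun_prop), lintegral_mixDensity_mul_exp h0]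
      simp [hI, h0.ne', mul_assoc]
  have hR : ∀ ω, H ω * ENNReal.ofReal √(1 + q ω) =
      H ω * I ω + ∫⁻ ξ : ℝ, H ω * ENNReal.ofReal (mixDensity (p ω) (q ω) ξ) *
        ENNReal.ofReal (Real.exp (ξ ^ 2 / 2)) := by
    intro ω
    rcases (hq0 ω).eq_or_lt with h0 | h0
    · simp [hI, mixDensity_zero, ← h0]
    · simp only [mul_assoc]
      rw [lintegral_const_mul _ (by fun_prop),
        lintegral_mixDensity_mul_exp_sq h0]
      simp [hI, h0.ne']
  simp only [hL, hR]
  have hHI : Measurable fun ω => H ω * I ω := hH0.mul hImeas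
  rw [lintegral_add_left hHI, lintegral_add_left hHI]
  -- After exchanging the integrals `ξ` is fixed, and `H` times the mixing density is
  -- `m`-measurable, so the bound for a single exponent applies.
  refine add_le_add le_rfl ((lintegral_lintegral_swap ?_).trans_le
    ((lintegral_mono fun ξ => ?_).trans_eq (lintegral_lintegral_swap ?_)))
  · fun_prop
  · exact h.lintegral_mul_exp_le hm hη ξ (hH.mul (by fun_prop))
  · fun_prop

/-- **Ville's inequality** for a nonnegative supermartingale started at `1`. -/
theorem measure_exists_le_of_supermartingale {ℱ : ℕ → MeasurableSpace Ω} (hℱ : ∀ t, ℱ t ≤ m0)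
    {Z : ℕ → Ω → ENNReal} (hZ : ∀ t, ∀ τ ≤ t, Measurable[ℱ t] (Z τ)) (hZ0 : ∀ ω, Z 0 ω = 1)
    (hstep : ∀ t s, MeasurableSet[ℱ t] s → ∫⁻ ω in s, Z (t + 1) ω ∂μ ≤ ∫⁻ ω in s, Z t ω ∂μ)
    {c : ENNReal} : μ {ω | ∃ t, c ≤ Z t ω} ≤ c⁻¹ := by
  let A : ℕ → Set Ω := fun n => {ω | ∃ t ≤ n, c ≤ Z t ω}
  have hA : ∀ n, MeasurableSet[ℱ n] (A n) := by
    intro n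
    have : A n = ⋃ t ∈ Set.Iic n, {ω | c ≤ Z t ω} := by
      ext ω; simp [A]
    rw [this]
    exact MeasurableSet.biUnion (Set.to_countable _) fun t ht => hZ n t ht measurableSet_Ici
  have hmono : Monotone A := fun a b hab ω ⟨t, ht, h⟩ => ⟨t, ht.trans hab, h⟩
  -- This bounds the process stopped on reaching `c`: mass stopped by time `n` counts at least `c`
  -- each, and the rest still carries `Z n`.
  have key : ∀ n, c * μ (A n) + ∫⁻ ω in (A n)ᶜ, Z n ω ∂μ ≤ 1 := by
    intro n
    induction n with
    | zero =>
      have h1 : c * μ (A 0) ≤ ∫⁻ ω in A 0, Z 0 ω ∂μ := by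
        rw [← setLIntegral_const]
        refine setLIntegral_mono' (hℱ 0 _ (hA 0)) fun ω ⟨t, ht, h⟩ => ?_
        rwa [Nat.le_zero.mp ht] at h
      calc _ ≤ ∫⁻ ω in A 0, Z 0 ω ∂μ + ∫⁻ ω in (A 0)ᶜ, Z 0 ω ∂μ := by gcongr
        _ = 1 := by rw [lintegral_add_compl _ (hℱ 0 _ (hA 0))]; simp [hZ0]
    | succ n ih =>
      have hAn := hℱ n _ (hA n)
      have hAn1 := hℱ _ _ (hA (n + 1))
      have hsub : A n ⊆ A (n + 1) := hmono n.le_succ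
      have h1 : c * μ (A (n + 1) \ A n) ≤ ∫⁻ ω in A (n + 1) \ A n, Z (n + 1) ω ∂μ := by
        rw [← setLIntegral_const]
        refine setLIntegral_mono' (hAn1.diff hAn) fun ω ⟨⟨t, ht, h⟩, hn⟩ => ?_
        rcases Nat.le_succ_iff.mp ht with h' | rfl
        · exact absurd ⟨t, h', h⟩ hn
        · exact h
      have h2 : (A n)ᶜ = (A (n + 1) \ A n) ∪ (A (n + 1))ᶜ := by
        ext ω
        by_cases h : ω ∈ A (n + 1) <;> by_cases h' : ω ∈ A n <;> simp [h, h']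
        exact h (hsub h')
      have h3 : ∫⁻ ω in (A n)ᶜ, Z (n + 1) ω ∂μ = ∫⁻ ω in A (n + 1) \ A n, Z (n + 1) ω ∂μ +
          ∫⁻ ω in (A (n + 1))ᶜ, Z (n + 1) ω ∂μ := by
        rw [h2, lintegral_union hAn1.compl]
        exact disjoint_compl_right.mono_left Set.sdiff_subset
      have h4 : μ (A (n + 1)) = μ (A n) + μ (A (n + 1) \ A n) := by
        rw [measure_add_sdiff hAn.nullMeasurableSet, Set.union_eq_self_of_subset_left hsub]
      calc c * μ (A (n + 1)) + ∫⁻ ω in (A (n + 1))ᶜ, Z (n + 1) ω ∂μ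
          ≤ c * μ (A n) + ∫⁻ ω in (A n)ᶜ, Z (n + 1) ω ∂μ := by
            rw [h4, h3, mul_add, add_assoc]
            gcongr
        _ ≤ c * μ (A n) + ∫⁻ ω in (A n)ᶜ, Z n ω ∂μ := by
            gcongr 1
            exact hstep n _ (MeasurableSet.compl (hA n))
        _ ≤ 1 := ih
  have hU : {ω | ∃ t, c ≤ Z t ω} = ⋃ n, A n := by
    ext ω
    simp only [A, Set.mem_iUnion]
    exact ⟨fun ⟨t, h⟩ => ⟨t, t, le_rfl, h⟩, fun ⟨_, t, _, h⟩ => ⟨t, h⟩⟩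
  rw [hU, hmono.measure_iUnion]
  refine iSup_le fun n => ?_
  rw [ENNReal.le_inv_iff_mul_le, mul_comm]
  exact le_self_add.trans (key n)

end mixture

/-! ### Self-normalised concentration. -/

section selfNormalized

variable {Ω : Type*} {m0 : MeasurableSpace Ω} {μ : Measure Ω} [IsProbabilityMeasure μ] {d : ℕ}

open Matrix

/-- The self-normalised process `(det (reg I) / det V_t)^{1/2} exp (‖S_t‖² / 2)`, with the norm of
`V_t⁻¹`. -/
noncomputable def selfNormProcess (reg : ℝ) (x : ℕ → Vec d) (η : ℕ → ℝ) (t : ℕ) : ℝ :=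
  Real.exp ((noiseSum x η t ⬝ᵥ (gramMatrix reg x t)⁻¹ *ᵥ noiseSum x η t - logDetRatio reg x t) / 2)

theorem selfNormProcess_zero {reg : ℝ} (hreg : 0 < reg) (x : ℕ → Vec d) (η : ℕ → ℝ) :
    selfNormProcess reg x η 0 = 1 := by
  have : reg ^ d ≠ 0 := by positivity
  simp [selfNormProcess, noiseSum, logDetRatio, gramMatrix_zero, div_self this]

/-- With `p = ⟨x_t, V⁻¹ S⟩` and `q = ‖x_t‖²_{V⁻¹}`, the increment is the one-step mixture. In the
Gaussian mixture picture `N(p, q)` is the law of `⟨x_t, ζ⟩` for `ζ` drawn from `N(V⁻¹ S, V⁻¹)`. -/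
theorem selfNormProcess_succ {reg : ℝ} (hreg : 0 < reg) (x : ℕ → Vec d) (η : ℕ → ℝ) (t : ℕ) :
    selfNormProcess reg x η (t + 1) = selfNormProcess reg x η t * (√(1 + sqWidth reg x t))⁻¹ *
      Real.exp ((2 * η t * ((x t).ofLp ⬝ᵥ (gramMatrix reg x t)⁻¹ *ᵥ noiseSum x η t) +
        η t ^ 2 * sqWidth reg x t -
        ((x t).ofLp ⬝ᵥ (gramMatrix reg x t)⁻¹ *ᵥ noiseSum x η t) ^ 2) /
          (2 * (1 + sqWidth reg x t))) := by
  have hV := posDef_gramMatrix x hreg t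
  have hq : 0 < 1 + sqWidth reg x t := by linarith [sqWidth_nonneg x hreg t]
  have h1 : (√(1 + sqWidth reg x t))⁻¹ = Real.exp (-Real.log (1 + sqWidth reg x t) / 2) := by
    rw [neg_div, Real.exp_neg, ← Real.log_sqrt hq.le, Real.exp_log (Real.sqrt_pos.mpr hq)]
  rw [h1, selfNormProcess, selfNormProcess, ← Real.exp_add, ← Real.exp_add]
  congr 1
  rw [noiseSum_succ, gramMatrix_succ, hV.dotProduct_inv_add_vecMulVec, logDetRatio_succ x hreg]
  change (_ + _ / (1 + sqWidth reg x t) - _) / 2 = _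
  rw [← sqWidth]
  field_simp
  ring

variable {ℱ : ℕ → MeasurableSpace Ω} {x : ℕ → Ω → Vec d} {η : ℕ → Ω → ℝ}

theorem measurable_selfNormProcess {m : MeasurableSpace Ω} (reg : ℝ) {t : ℕ}
    (hx : ∀ τ < t, Measurable (x τ)) (hη : ∀ τ < t, Measurable (η τ)) :
    Measurable fun ω => selfNormProcess reg (fun τ => x τ ω) (fun τ => η τ ω) t :=
  Real.measurable_exp.comp (((Matrix.measurable_dotProduct_inv_mulVec
    (measurable_gramMatrix_apply reg hx) (measurable_noiseSum_apply hx hη)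
    (measurable_noiseSum_apply hx hη)).sub (measurable_logDetRatio reg hx)).div_const _)

/-- The self-normalised concentration inequality. -/
theorem measure_exists_le_selfNormProcess {reg : ℝ} (hreg : 0 < reg) (hℱ : ∀ t, ℱ t ≤ m0)
    (hx : ∀ t, ∀ τ ≤ t, Measurable[ℱ t] (x τ)) (hη : ∀ t, ∀ τ < t, Measurable[ℱ t] (η τ))
    (h : ∀ t, CondSubGaussian μ (ℱ t) (η t)) {c : ℝ} (hc : 0 < c) :
    μ {ω | ∃ t, c ≤ selfNormProcess reg (fun τ => x τ ω) (fun τ => η τ ω) t} ≤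
      ENNReal.ofReal c⁻¹ := by
  have hpos : ∀ t ω, 0 ≤ selfNormProcess reg (fun τ => x τ ω) (fun τ => η τ ω) t :=
    fun t ω => (Real.exp_pos _).le
  have hset : {ω | ∃ t, c ≤ selfNormProcess reg (fun τ => x τ ω) (fun τ => η τ ω) t} =
      {ω | ∃ t, ENNReal.ofReal c ≤
        ENNReal.ofReal (selfNormProcess reg (fun τ => x τ ω) (fun τ => η τ ω) t)} := by
    ext ω
    exact exists_congr fun t => (ENNReal.ofReal_le_ofReal_iff (hpos t ω)).symm
  rw [hset, ENNReal.ofReal_inv_of_pos hc]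
  refine measure_exists_le_of_supermartingale hℱ (fun t τ hτ => ?_)
    (fun ω => by rw [selfNormProcess_zero hreg, ENNReal.ofReal_one]) (fun t s hs => ?_)
  · exact ENNReal.measurable_ofReal.comp (measurable_selfNormProcess reg
      (fun τ' h' => hx t τ' (h'.le.trans hτ)) fun τ' h' => hη t τ' (h'.trans_le hτ))
  · have hxt : ∀ τ < t, Measurable[ℱ t] (x τ) := fun τ hτ => hx t τ hτ.le
    have hxi := fun i => Vec.measurable_apply (hx t t le_rfl) i
    have hp := Matrix.measurable_dotProduct_inv_mulVec (measurable_gramMatrix_apply reg hxt) hxi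
      (measurable_noiseSum_apply hxt (hη t))
    have hq : Measurable[ℱ t] fun ω => sqWidth reg (fun τ => x τ ω) t :=
      Matrix.measurable_dotProduct_inv_mulVec (measurable_gramMatrix_apply reg hxt) hxi hxi
    have hZ := ENNReal.measurable_ofReal.comp (measurable_selfNormProcess reg hxt (hη t))
    have hr : Measurable[ℱ t] fun ω =>
        ENNReal.ofReal (√(1 + sqWidth reg (fun τ => x τ ω) t))⁻¹ :=
      ENNReal.measurable_ofReal.comp ((hq.const_add 1).sqrt.inv)
    -- The weight is the indicator of `s` times `Z_t / √(1 + q)`, so that the factor `√(1 + q)` in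
    -- the bound cancels.
    have key := (h t).lintegral_mul_exp_quadratic_le (hℱ t)
      ((hη (t + 1) t t.lt_succ_self).mono (hℱ _) le_rfl) hp hq
      (fun ω => sqWidth_nonneg (fun τ => x τ ω) hreg t) (fun ω h0 => ?_)
      (((hZ.mul hr)).indicator hs)
    · rw [← lintegral_indicator (hℱ t s hs), ← lintegral_indicator (hℱ t s hs)]
      convert key using 1
      · refine lintegral_congr fun ω => ?_
        by_cases hω : ω ∈ s
        · simp only [Set.indicator_of_mem hω, selfNormProcess_succ hreg, Pi.mul_apply,
            Function.comp_apply]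
          rw [ENNReal.ofReal_mul (by have := hpos t ω; positivity), ENNReal.ofReal_mul (hpos t ω)]
        · simp [hω]
      · refine lintegral_congr fun ω => ?_
        by_cases hω : ω ∈ s
        · simp only [Set.indicator_of_mem hω, Pi.mul_apply, Function.comp_apply]
          have h1 : 0 < √(1 + sqWidth reg (fun τ => x τ ω) t) :=
            Real.sqrt_pos.mpr (by linarith [sqWidth_nonneg (fun τ => x τ ω) hreg t])
          rw [mul_assoc, ← ENNReal.ofReal_mul (inv_pos.mpr h1).le, inv_mul_cancel₀ h1.ne',
            ENNReal.ofReal_one, mul_one]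
        · simp [hω]
    -- Zero width forces `p = 0` by Cauchy–Schwarz for `V⁻¹`.
    · have hV := (posDef_gramMatrix (fun τ => x τ ω) hreg t).inv
      have h1 := hV.posSemidef.sq_dotProduct_mulVec_le (x t ω).ofLp
        (noiseSum (fun τ => x τ ω) (fun τ => η τ ω) t)
      rw [show (x t ω).ofLp ⬝ᵥ (gramMatrix reg (fun τ => x τ ω) t)⁻¹ *ᵥ (x t ω).ofLp = 0 from h0,
        zero_mul] at h1
      exact pow_eq_zero_iff two_ne_zero |>.mp (le_antisymm h1 (sq_nonneg _))

end selfNormalized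

/-! ### The information available in each round. -/

section infoSigma

variable {Ω : Type*} {d K U : ℕ} {x : ℕ → Ω → Vec d} {r : ℕ → Ω → ℝ}
  {s : ℕ → ConIdx K U → Ω → ℝ}

theorem measurable_infoSigma_action {t τ : ℕ} (h : τ ≤ t) : Measurable[infoSigma x r s t] (x τ) :=
  Measurable.of_comap_le (((le_iSup (fun τ : Fin (t + 1) =>
    MeasurableSpace.comap (x τ) inferInstance) ⟨τ, Nat.lt_succ_of_le h⟩).trans le_sup_left).trans
      le_sup_left)

theorem measurable_infoSigma_reward {t τ : ℕ} (h : τ < t) : Measurable[infoSigma x r s t] (r τ) :=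
  Measurable.of_comap_le (((le_iSup (fun τ : Fin t =>
    MeasurableSpace.comap (r τ) inferInstance) ⟨τ, h⟩).trans le_sup_right).trans le_sup_left)

theorem measurable_infoSigma_safety {t τ : ℕ} (h : τ < t) (i : ConIdx K U) :
    Measurable[infoSigma x r s t] (s τ i) :=
  Measurable.of_comap_le (((le_iSup (fun i : ConIdx K U =>
    MeasurableSpace.comap (s τ i) inferInstance) i).trans (le_iSup (fun τ : Fin t =>
      ⨆ i : ConIdx K U, MeasurableSpace.comap (s τ i) inferInstance) ⟨τ, h⟩)).trans le_sup_right)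

theorem infoSigma_le {m0 : MeasurableSpace Ω} (hx : ∀ t, Measurable (x t))
    (hr : ∀ t, Measurable (r t)) (hs : ∀ t i, Measurable (s t i)) (t : ℕ) :
    infoSigma x r s t ≤ m0 :=
  sup_le (sup_le (iSup_le fun τ => (hx τ).comap_le) (iSup_le fun τ => (hr τ).comap_le))
    (iSup_le fun τ => iSup_le fun i => (hs τ i).comap_le)

end infoSigma

/-! ### The event on which all confidence sets are valid, and the count of bad rounds. -/

namespace SafeBandit

variable {d K U : ℕ} {Ω : Type*}

/-- Past noise is the observed feedback minus its mean, a function of the past action. -/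
theorem measurable_infoSigma_noise (B : SafeBandit d K U) (x : ℕ → Ω → Vec d)
    (γ : ℕ → Option (ConIdx K U) → Ω → ℝ) {t τ : ℕ} (h : τ < t) (i : Option (ConIdx K U)) :
    Measurable[infoSigma x (B.reward x γ) (B.safety x γ) t] (γ τ i) := by
  let : MeasurableSpace Ω := infoSigma x (B.reward x γ) (B.safety x γ) t
  have hx : Measurable (x τ) := measurable_infoSigma_action h.le
  cases i with
  | none =>
    have hr : Measurable (B.reward x γ τ) := measurable_infoSigma_reward h
    have : γ τ none = fun ω => B.reward x γ τ ω - inner ℝ B.θ (x τ ω) := by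
      ext ω; simp [reward]
    rw [this]
    exact hr.sub (measurable_const.inner hx)
  | some i =>
    have hs : Measurable (B.safety x γ τ i) := measurable_infoSigma_safety h i
    have : γ τ (some i) = fun ω => B.safety x γ τ i ω - inner ℝ (B.a i) (x τ ω) := by
      ext ω; simp [safety]
    rw [this]
    exact hs.sub (measurable_const.inner hx)

/-- With probability at least `1 - δ`, all confidence sets always contain the true parameters. -/
theorem exists_goodEvent {m0 : MeasurableSpace Ω} {μ : Measure Ω} [IsProbabilityMeasure μ]
    (B : SafeBandit d K U) {reg δ : ℝ} (hreg : 0 < reg) (hδ : 0 < δ)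
    {x : ℕ → Ω → Vec d} {γ : ℕ → Option (ConIdx K U) → Ω → ℝ} (hθ : ‖B.θ‖ ≤ 1)
    (ha : ∀ i, ‖B.a i‖ ≤ 1) (hx : ∀ t, Measurable (x t)) (hγ : ∀ t i, Measurable (γ t i))
    (h : ∀ t i, CondSubGaussian μ (infoSigma x (B.reward x γ) (B.safety x γ) t) (γ t i)) :
    ∃ G : Set Ω, MeasurableSet G ∧ 1 - δ ≤ μ.real G ∧ ∀ ω ∈ G, ∀ t,
      B.θ ∈ confEllipsoid U reg δ (fun τ => x τ ω) (fun τ => B.reward x γ τ ω) t ∧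
      ∀ i, B.a i ∈ B.conf reg δ (fun τ => x τ ω) (fun τ i => B.safety x γ τ i ω) t i := by
  -- Each of the `U + 1` regressions, one for the reward and one per unknown constraint, may fail
  -- with probability `1/c`, for a total of `δ`.
  let c : ℝ := ((U : ℝ) + 1) / δ
  have hc : 0 < c := by positivity
  let idx : Option (Fin U) → Option (ConIdx K U) := Option.map Sum.inr
  let bad : Option (Fin U) → Set Ω := fun k =>
    {ω | ∃ t, c ≤ selfNormProcess reg (fun τ => x τ ω) (fun τ => γ τ (idx k) ω) t}
  have hr : ∀ t, Measurable (B.reward x γ t) := fun t =>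
    (measurable_const.inner (hx t)).add (hγ t none)
  have hs : ∀ t i, Measurable (B.safety x γ t i) := fun t i =>
    (measurable_const.inner (hx t)).add (hγ t (some i))
  have hbad : ∀ k, MeasurableSet (bad k) := by
    intro k
    have : bad k = ⋃ t, {ω | c ≤ selfNormProcess reg (fun τ => x τ ω)
        (fun τ => γ τ (idx k) ω) t} := by
      ext ω; simp [bad]
    rw [this]
    exact MeasurableSet.iUnion fun t => (measurable_selfNormProcess reg (fun τ _ => hx τ)
      fun τ _ => hγ τ (idx k)) measurableSet_Ici
  have hμ : ∀ k, μ (bad k) ≤ ENNReal.ofReal c⁻¹ := fun k =>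
    measure_exists_le_selfNormProcess hreg (infoSigma_le hx hr hs)
      (fun t τ hτ => measurable_infoSigma_action hτ)
      (fun t τ hτ => B.measurable_infoSigma_noise x γ hτ (idx k)) (fun t => h t (idx k)) hc
  have hUn : μ (⋃ k, bad k) ≤ ENNReal.ofReal δ := by
    calc μ (⋃ k, bad k) ≤ ∑ k, μ (bad k) := measure_iUnion_fintype_le μ bad
      _ ≤ ∑ _k : Option (Fin U), ENNReal.ofReal c⁻¹ := Finset.sum_le_sum fun k _ => hμ k
      _ = ENNReal.ofReal (∑ _k : Option (Fin U), c⁻¹) :=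
          (ENNReal.ofReal_sum_of_nonneg fun _ _ => (inv_pos.mpr hc).le).symm
      _ = ENNReal.ofReal δ := by
          congr 1
          simp only [Finset.sum_const, Finset.card_univ, Fintype.card_option, Fintype.card_fin,
            nsmul_eq_mul, c]
          push_cast
          field_simp
  have hm := MeasurableSet.iUnion hbad
  refine ⟨(⋃ k, bad k)ᶜ, hm.compl, ?_, fun ω hω t => ?_⟩
  · rw [probReal_compl_eq_one_sub hm]
    have : μ.real (⋃ k, bad k) ≤ δ := ENNReal.toReal_le_of_le_ofReal hδ.le hUn
    linarith
  have hsmall : ∀ k, noiseSum (fun τ => x τ ω) (fun τ => γ τ (idx k) ω) t ⬝ᵥ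
      ((gramMatrix reg (fun τ => x τ ω) t)⁻¹.mulVec
        (noiseSum (fun τ => x τ ω) (fun τ => γ τ (idx k) ω) t)) ≤
      2 * Real.log (((U : ℝ) + 1) / δ) + logDetRatio reg (fun τ => x τ ω) t := by
    intro k
    have h1 : selfNormProcess reg (fun τ => x τ ω) (fun τ => γ τ (idx k) ω) t < c := by
      by_contra hcon
      exact hω (Set.mem_iUnion.mpr ⟨k, t, not_lt.mp hcon⟩)
    have h2 := (Real.lt_log_iff_exp_lt hc).mpr h1
    change _ < Real.log (((U : ℝ) + 1) / δ) at h2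
    linarith
  refine ⟨mem_confEllipsoid_of_noiseSum _ hreg hδ hθ (fun τ => rfl) (hsmall none), fun i => ?_⟩
  rcases i with i | i
  · exact rfl
  · exact mem_confEllipsoid_of_noiseSum _ hreg hδ (ha _) (fun τ => rfl) (hsmall (some i))

/-- The number of bad rounds, in terms of the confidence radii and the widths. -/
theorem gap_sq_mul_numBadRounds_le {B : SafeBandit d K U} {xs : Vec d} {reg δ R : ℝ}
    (hreg : 0 < reg) {x : ℕ → Vec d} {s : ℕ → ConIdx K U → ℝ} {T : ℕ} (hx : ∀ t, ‖x t‖ ≤ 1)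
    (hR : ∀ t < T, confRadius U reg δ x t ^ 2 ≤ R)
    (hgap : ∀ t I, B.IsSuboptimalBIS xs I → B.NoisyAssoc reg δ x s t I (x t) →
      B.gap xs ≤ 2 * (confRadius U reg δ x t * √(sqWidth reg x t))) :
    B.gap xs ^ 2 * (B.numBadRounds xs reg δ x s T : ℝ) ≤
      4 * R * ((1 + 1 / reg) * logDetRatio reg x T) := by
  classical
  rcases T.eq_zero_or_pos with rfl | hT
  · have : reg ^ d ≠ 0 := by positivity
    simp [numBadRounds, logDetRatio, gramMatrix_zero, div_self this]
  have hR0 : 0 ≤ R := (sq_nonneg _).trans (hR 0 hT)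
  rw [numBadRounds, mul_comm, ← nsmul_eq_mul, ← Finset.sum_const]
  calc _ ≤ ∑ t ∈ (Finset.range T).filter fun t =>
        ∃ I, B.IsSuboptimalBIS xs I ∧ B.NoisyAssoc reg δ x s t I (x t), 4 * R * sqWidth reg x t := by
        refine Finset.sum_le_sum fun t ht => ?_
        obtain ⟨ht, I, hI, hIt⟩ := Finset.mem_filter.mp ht
        have hq := sqWidth_nonneg x hreg t
        calc B.gap xs ^ 2 ≤ (2 * (confRadius U reg δ x t * √(sqWidth reg x t))) ^ 2 :=
              pow_le_pow_left₀ (B.gap_nonneg xs) (hgap t I hI hIt) 2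
          _ = 4 * confRadius U reg δ x t ^ 2 * sqWidth reg x t := by
              rw [mul_pow, mul_pow, Real.sq_sqrt hq]; ring
          _ ≤ _ := by
              gcongr
              exact hR t (Finset.mem_range.mp ht)
    _ ≤ ∑ t ∈ Finset.range T, 4 * R * sqWidth reg x t :=
        Finset.sum_le_sum_of_subset_of_nonneg (Finset.filter_subset _ _) fun t _ _ =>
          mul_nonneg (by positivity) (sqWidth_nonneg x hreg t)
    _ ≤ _ := by
        rw [← Finset.mul_sum]
        exact mul_le_mul_of_nonneg_left (sum_sqWidth_le x hreg T hx) (by positivity)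

end SafeBandit

/-! ### Explicit constants and the theorem. -/

theorem confRadius_sq_le {d : ℕ} {reg δ : ℝ} (hreg : 0 < reg) (hδ : 0 < δ) (hδ1 : δ < 1)
    (x : ℕ → Vec d) {U t T : ℕ} (ht : t ≤ T) :
    confRadius U reg δ x t ^ 2 ≤
      4 * Real.log (((U : ℝ) + 1) / δ) + 2 * logDetRatio reg x T + 2 * reg := by
  rw [confRadius_eq x hreg hδ]
  have hc : 0 ≤ Real.log (((U : ℝ) + 1) / δ) := Real.log_nonneg (by
    rw [le_div_iff₀ hδ]
    have : (0 : ℝ) ≤ U := U.cast_nonneg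
    linarith)
  have h1 := logDetRatio_nonneg x hreg t
  have h2 := logDetRatio_mono x hreg ht
  have h3 := add_sq_le (a := √(2 * Real.log (((U : ℝ) + 1) / δ) + logDetRatio reg x t))
    (b := √reg)
  rw [Real.sq_sqrt (by positivity), Real.sq_sqrt hreg.le] at h3
  linarith

/-- For `T ≥ 2` one has `1 + T/reg ≤ T (1 + 1/reg)`, and the constant `log (1 + 1/reg)` is absorbed
using `log T ≥ log 2`. -/
theorem log_one_add_div_le {reg : ℝ} (hreg : 0 < reg) {T : ℕ} (hT : 2 ≤ T) :
    Real.log (1 + T / reg) ≤ (1 + Real.log (1 + 1 / reg) / Real.log 2) * Real.log T := by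
  have hT' : (2 : ℝ) ≤ T := by exact_mod_cast hT
  have h2 : 0 < Real.log 2 := Real.log_pos one_lt_two
  have hT2 : Real.log 2 ≤ Real.log T := Real.log_le_log two_pos hT'
  have h0 : 0 ≤ Real.log (1 + 1 / reg) :=
    Real.log_nonneg (by linarith [one_div_pos.mpr hreg])
  have h3 : Real.log (1 + T / reg) ≤ Real.log (T * (1 + 1 / reg)) := by
    refine Real.log_le_log (by positivity) ?_
    rw [mul_add, mul_one, mul_one_div]
    linarith
  rw [Real.log_mul (by positivity) (by positivity)] at h3
  have h4 : Real.log (1 + 1 / reg) ≤ Real.log (1 + 1 / reg) / Real.log 2 * Real.log T := by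
    rw [div_mul_eq_mul_div, le_div_iff₀ h2]
    exact mul_le_mul_of_nonneg_left hT2 h0
  linarith

theorem mainTheorem4 (reg : ℝ) (hreg : 0 < reg) :
    ∃ C : ℝ, 0 < C ∧
      ∀ (d K U : ℕ) (B : SafeBandit d K U) (xs : Vec d) (δ : ℝ)
        (Ω : Type*) [MeasurableSpace Ω] (μ : Measure Ω) [IsProbabilityMeasure μ]
        (x θt : ℕ → Ω → Vec d) (γ : ℕ → Option (ConIdx K U) → Ω → ℝ),
        0 < δ → δ < 1 →
        -- the known domain is a polytope in the unit ball, the parameters are bounded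
        B.knownDomain ⊆ Metric.closedBall 0 1 →
        ‖B.θ‖ ≤ 1 → (∀ i, ‖B.a i‖ ≤ 1) →
        -- unique optimum, non-degeneracy
        B.IsUniqueOptimum xs → B.Nondegenerate →
        -- conditionally sub-Gaussian noise
        (∀ t, Measurable (x t)) → (∀ t i, Measurable (γ t i)) →
        (∀ t i, CondSubGaussian μ (infoSigma x (B.reward x γ) (B.safety x γ) t) (γ t i)) →
        -- the actions are those of DOSLB
        (∀ ω t, B.IsDOSLBRound reg δ (fun τ => x τ ω) (fun τ => θt τ ω)
          (fun τ => B.reward x γ τ ω) (fun τ i => B.safety x γ τ i ω) t) →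
        ∃ G : Set Ω, MeasurableSet G ∧ 1 - δ ≤ μ.real G ∧ ∀ ω ∈ G,
          (∀ t, inner ℝ (θt t ω) (x t ω) ≠ 0 →
            ∃ I, B.IsBIS I ∧ B.NoisyAssoc reg δ (fun τ => x τ ω)
              (fun τ i => B.safety x γ τ i ω) t I (x t ω)) ∧
          ∀ T : ℕ, 2 ≤ T →
            B.gap xs ^ 2 * (B.numBadRounds xs reg δ (fun τ => x τ ω)
                (fun τ i => B.safety x γ τ i ω) T : ℝ) ≤
              C * (1 + Real.log (((U : ℝ) + 1) / δ)) * ((d : ℝ) * Real.log T) ^ 2 := by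
  set C₁ : ℝ := 1 + Real.log (1 + 1 / reg) / Real.log 2 with hC₁
  have hlog2 : 0 < Real.log 2 := Real.log_pos one_lt_two
  have hC₁0 : 0 < C₁ := by
    have : 0 ≤ Real.log (1 + 1 / reg) := Real.log_nonneg (by linarith [one_div_pos.mpr hreg])
    positivity
  refine ⟨4 * (1 + 1 / reg) * C₁ * (8 + 2 * C₁ + 4 * reg), by positivity, ?_⟩
  intro d K U B xs δ Ω _ μ _ x θt γ hδ hδ1 hK hθ ha hopt _ hx hγ hsub hplay
  obtain ⟨G, hG, hGδ, hconf⟩ := B.exists_goodEvent hreg hδ hθ ha hx hγ hsub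
  refine ⟨G, hG, hGδ, fun ω hω => ⟨fun t h0 => ?_, fun T hT => ?_⟩⟩
  · refine (hplay ω t).exists_noisyAssoc hreg ⟨xs, hopt.1.1, fun i => ⟨B.a i, (hconf ω hω t).2 i, ?_⟩⟩
      h0
    rcases i with i | i
    · exact hopt.1.1 i
    · exact hopt.1.2 i
  have hx1 : ∀ t, ‖x t ω‖ ≤ 1 := fun t => by simpa using hK (hplay ω t).1
  have hmain := SafeBandit.gap_sq_mul_numBadRounds_le (B := B) (xs := xs) (δ := δ) (T := T) hreg hx1
    (fun t ht => confRadius_sq_le hreg hδ hδ1 (fun τ => x τ ω) ht.le)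
    (fun t I hI hIt => ((hplay ω t).nearlyBasic hreg hopt.1 (hconf ω hω t).1 (hconf ω hω t).2
      hIt).gap_le hK hI)
  refine hmain.trans ?_
  set l := Real.log (((U : ℝ) + 1) / δ)
  have hl : 0 ≤ l := Real.log_nonneg (by
    rw [le_div_iff₀ hδ]
    have : (0 : ℝ) ≤ U := U.cast_nonneg
    linarith)
  have hD0 := logDetRatio_nonneg (fun τ => x τ ω) hreg T
  have hD : logDetRatio reg (fun τ => x τ ω) T ≤ C₁ * (d * Real.log T) := by
    refine (logDetRatio_le (fun τ => x τ ω) hreg T hx1).trans ?_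
    calc (d : ℝ) * Real.log (1 + T / reg) ≤ d * (C₁ * Real.log T) := by
          gcongr
          exact log_one_add_div_le hreg hT
      _ = _ := by ring
  set D := logDetRatio reg (fun τ => x τ ω) T
  have hT' : (2 : ℝ) ≤ T := by exact_mod_cast hT
  have hlogT : 1 / 2 ≤ Real.log T := by
    have := Real.log_le_log two_pos hT'
    linarith [Real.log_two_gt_d9]
  -- For `d = 0` both sides vanish. For `d ≥ 1` one has `d log T ≥ 1/2`, which lets the terms
  -- without `d log T` be absorbed at the price of a factor `2`; hence `8` and `4 * reg`.
  rcases d.eq_zero_or_pos with hd | hd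
  · have : D = 0 := le_antisymm (by simpa [hd] using hD) hD0
    rw [this]
    simp [hd]
  have hd1 : (1 : ℝ) ≤ d := by exact_mod_cast hd
  have hy : 1 / 2 ≤ d * Real.log T := by nlinarith
  set y := (d : ℝ) * Real.log T
  have h1 : 4 * l + 2 * D + 2 * reg ≤ (8 + 2 * C₁ + 4 * reg) * ((1 + l) * y) := by
    have e1 : 4 * l ≤ 8 * (l * y) := by nlinarith
    have e2 : 2 * reg ≤ 4 * reg * y := by nlinarith
    have e3 : 0 ≤ C₁ * (l * y) := by positivity
    have e4 : 0 ≤ reg * (l * y) := by positivity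
    nlinarith
  calc 4 * (4 * l + 2 * D + 2 * reg) * ((1 + 1 / reg) * D)
      ≤ 4 * ((8 + 2 * C₁ + 4 * reg) * ((1 + l) * y)) * ((1 + 1 / reg) * (C₁ * y)) := by gcongr
    _ = _ := by ring
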